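/- Let $n\ge 2$. For an open set $\Omega\subset\mathbb R^n$ and $T>0$ put $Q=\Omega\times(0,T)$. (1) For every nonempty open set $\Omega\subset\mathbb R^n$ (in particular for every bounded smooth domain) and every $T>0$, the space $L^2(0,T;H^2(\Omega)\cap H^1_0(\Omega))\cap H^1(0,T;L^2(\Omega))$ is not contained in $L^\infty(Q)$. (2) There are functions $\phi\in C_c^\infty(\mathbb R^{n+1})$ with $0\le\phi\le1$, $\phi=1$ on $B_1(0)\times[-1,1]$ and $\phi=0$ outside $B_2(0)\times[-2,2]$. Let $\phi$ be any such function, let $\Omega=B_2(0)$, $T=2$, $Q=B_2(0)\times(0,2)$, and $$y(x,t)=\sum_{k=1}^\infty k^{-1}\,\phi\big(2^kx,\,2^{2k}(t-1)\big).$$ For $(x,t)\neq(0,1)$ only finitely many summands are nonzero. Moreover $y\in L^2(0,T;H^2(\Omega)\cap H^1_0(\Omega))\cap H^1(0,T;L^2(\Omega))$, $y(x,0)=0$ for all $x$, and $y\notin L^\infty(Q)$. (3) With $\phi$, $\Omega$, $T$, $Q$, $y$ as in (2), the function $u=\partial_t y-\Delta y$ lies in $L^2(Q)$, and $y$ is the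 unique solution in $W(0,T)=L^2(0,T;H^1_0(\Omega))\cap H^1(0,T;H^{-1}(\Omega))$ of $$\partial_t y-\Delta y=u\ \text{ in }Q,\qquad y=0\ \text{ on }\partial\Omega\times(0,T),\qquad y(\cdot,0)=0\ \text{ in }\Omega.$$ (4) If moreover $n=2$ or $n=3$, then $u=\partial_t y-\Delta y+y^3$ lies in $L^2(Q)$, and the unbounded function $y$ is the state associated with the control $u$, that is, the unique solution $y\in W(0,T)$ with $y^3\in L^2(Q)$ of $$\partial_t y-\Delta y+y^3=u\ \text{ in }Q,\qquad y=0\ \text{ on }\partial\Omega\times(0,T),\qquad y(\cdot,0)=0\ \text{ in }\Omega.$$ -/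

import Mathlib

open MeasureTheory Set Filter Topology
open scoped ContDiff

noncomputable section

namespace ParabolicExample

/-! ### Spaces of functions of the space variable -/

/-- The space `ℝⁿ` with its Euclidean norm. -/
abbrev Euc (n : ℕ) : Type := EuclideanSpace ℝ (Fin n)

/-- `φ ∈ C_c^∞(U)`. -/
def IsTest {V : Type*} [NormedAddCommGroup V] [NormedSpace ℝ V] (U : Set V) (φ : V → ℝ) : Prop :=
  ContDiff ℝ ∞ φ ∧ HasCompactSupport φ ∧ tsupport φ ⊆ U

/-- The classical partial derivative `∂ᵢφ`. -/
def pd {n : ℕ} (i : Fin n) (φ : Euc n → ℝ) (x : Euc n) : ℝ :=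
  fderiv ℝ φ x (EuclideanSpace.single i 1)

/-- `L²(Ω)`. -/
abbrev L2 {n : ℕ} (Ω : Set (Euc n)) : Type := Lp ℝ 2 (volume.restrict Ω)

/-- Pairs `(v, (gᵢ)ᵢ)` in `L²(Ω) × L²(Ω)ⁿ` with the Hilbert norm
`(‖v‖² + ∑ᵢ ‖gᵢ‖²)^{1/2}`; for `gᵢ = ∂ᵢv` this is the norm of `H¹(Ω)`. -/
abbrev Jet1 {n : ℕ} (Ω : Set (Euc n)) : Type :=
  WithLp 2 (L2 Ω × PiLp 2 (fun _ : Fin n => L2 Ω))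

/-- Triples `(v, (gᵢ)ᵢ, (hᵢⱼ)ᵢⱼ)` in `L²(Ω)` with the Hilbert norm; for `gᵢ = ∂ᵢv` and
`hᵢⱼ = ∂ⱼ∂ᵢv` this is the norm of `H²(Ω)`. -/
abbrev Jet2 {n : ℕ} (Ω : Set (Euc n)) : Type :=
  WithLp 2 (Jet1 Ω × PiLp 2 (fun _ : Fin n × Fin n => L2 Ω))

/-- `w` is the weak partial derivative `∂ᵢv` in `Ω`. -/
def HasWeakPartial {n : ℕ} (Ω : Set (Euc n)) (i : Fin n) (v w : L2 Ω) : Prop :=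
  ∀ φ : Euc n → ℝ, IsTest Ω φ →
    ∫ x in Ω, v x * pd i φ x = -∫ x in Ω, w x * φ x

/-- `V` is the 2-jet `(v, ∇v, D²v)` of a function `v ∈ H²(Ω)`, all derivatives being weak. -/
def IsH2 {n : ℕ} (Ω : Set (Euc n)) (V : Jet2 Ω) : Prop :=
  (∀ i, HasWeakPartial Ω i V.fst.fst (V.fst.snd i)) ∧
    ∀ i j, HasWeakPartial Ω j (V.fst.snd i) (V.snd (i, j))

/-- `H¹₀(Ω)`, the closure of `C_c^∞(Ω)` in the norm of `H¹(Ω)`; its elements are pairs `(v, ∇v)`.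
(The set inside `span` is already a linear subspace.) -/
def H10 {n : ℕ} (Ω : Set (Euc n)) : Submodule ℝ (Jet1 Ω) :=
  (Submodule.span ℝ {V : Jet1 Ω | ∃ φ : Euc n → ℝ, IsTest Ω φ ∧
    V.fst =ᵐ[volume.restrict Ω] φ ∧
    ∀ i, V.snd i =ᵐ[volume.restrict Ω] pd i φ}).topologicalClosure

/-- `H⁻¹(Ω)`, the dual space of `H¹₀(Ω)`. -/
abbrev HMinusOne {n : ℕ} (Ω : Set (Euc n)) : Type := StrongDual ℝ (H10 Ω)

/-- The embedding `H¹₀(Ω) → L²(Ω)`. -/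
def H10.toL2 {n : ℕ} (Ω : Set (Euc n)) : H10 Ω →L[ℝ] L2 Ω :=
  (WithLp.fstL 2 ℝ (L2 Ω) (PiLp 2 (fun _ : Fin n => L2 Ω))).comp (H10 Ω).subtypeL

/-- The embedding `L²(Ω) → H⁻¹(Ω)`, `w ↦ (v ↦ ∫_Ω w v)`. -/
def L2.toHMinusOne {n : ℕ} (Ω : Set (Euc n)) (w : L2 Ω) : HMinusOne Ω :=
  (innerSL ℝ w).comp (H10.toL2 Ω)

/-! ### Functions on the space-time cylinder -/

/-- The cylinder `Q = Ω × (0,T)`. -/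
def Cyl {n : ℕ} (Ω : Set (Euc n)) (T : ℝ) : Set (Euc n × ℝ) := Ω ×ˢ Ioo 0 T

/-- `Y ∈ L²(0,T;X)` (Bochner). -/
def MemL2Time {X : Type*} [NormedAddCommGroup X] (T : ℝ) (Y : ℝ → X) : Prop :=
  MemLp Y 2 (volume.restrict (Ioo 0 T))

/-- `Y'` is the weak (distributional) derivative of `Y : (0,T) → X`. -/
def HasWeakTimeDeriv {X : Type*} [NormedAddCommGroup X] [NormedSpace ℝ X]
    (T : ℝ) (Y Y' : ℝ → X) : Prop :=
  ∀ ψ : ℝ → ℝ, IsTest (Ioo 0 T) ψ →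
    ∫ t in Ioo 0 T, deriv ψ t • Y t = -∫ t in Ioo 0 T, ψ t • Y' t

/-- The vector-valued function `Y` is `t ↦ y(·,t)`. -/
def Represents {n : ℕ} (Ω : Set (Euc n)) (T : ℝ) (Y : ℝ → L2 Ω) (y : Euc n × ℝ → ℝ) : Prop :=
  ∀ᵐ t ∂(volume.restrict (Ioo 0 T)), Y t =ᵐ[volume.restrict Ω] fun x => y (x, t)

/-- `y ∈ L²(0,T; H²(Ω) ∩ H¹₀(Ω))`. -/
def MemL2H2H10 {n : ℕ} (Ω : Set (Euc n)) (T : ℝ) (y : Euc n × ℝ → ℝ) : Prop :=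
  ∃ Y : ℝ → Jet2 Ω, MemL2Time T Y ∧
    (∀ᵐ t ∂(volume.restrict (Ioo 0 T)), IsH2 Ω (Y t) ∧ (Y t).fst ∈ H10 Ω) ∧
    Represents Ω T (fun t => (Y t).fst.fst) y

/-- `y ∈ H¹(0,T; L²(Ω))`. -/
def MemH1L2 {n : ℕ} (Ω : Set (Euc n)) (T : ℝ) (y : Euc n × ℝ → ℝ) : Prop :=
  ∃ Y Y' : ℝ → L2 Ω, MemL2Time T Y ∧ MemL2Time T Y' ∧ HasWeakTimeDeriv T Y Y' ∧
    Represents Ω T Y y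

/-- `L²(0,T; H²(Ω) ∩ H¹₀(Ω)) ∩ H¹(0,T; L²(Ω))`, as a set of functions `y ∈ L²(Q)`. -/
def strongSpace {n : ℕ} (Ω : Set (Euc n)) (T : ℝ) : Set (Euc n × ℝ → ℝ) :=
  {y | MemLp y 2 (volume.restrict (Cyl Ω T)) ∧ MemL2H2H10 Ω T y ∧ MemH1L2 Ω T y}

/-- `L^∞(Q)`. -/
def LInfty {n : ℕ} (Ω : Set (Euc n)) (T : ℝ) : Set (Euc n × ℝ → ℝ) :=
  {y | MemLp y ⊤ (volume.restrict (Cyl Ω T))}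

/-- The function `y ∈ L²(Q)` lies in `W(0,T) = L²(0,T;H¹₀(Ω)) ∩ H¹(0,T;H⁻¹(Ω))`, where
`Y t = y(·,t)` in `H¹₀(Ω)` and `Y'` is its weak time derivative, with values in `H⁻¹(Ω)`. -/
structure IsW {n : ℕ} (Ω : Set (Euc n)) (T : ℝ) (y : Euc n × ℝ → ℝ)
    (Y : ℝ → H10 Ω) (Y' : ℝ → HMinusOne Ω) : Prop where
  memLp : MemLp y 2 (volume.restrict (Cyl Ω T))
  memL2 : MemL2Time T Y
  memL2_deriv : MemL2Time T Y'
  deriv : HasWeakTimeDeriv T (fun t => L2.toHMinusOne Ω (H10.toL2 Ω (Y t))) Y'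
  represents : Represents Ω T (fun t => H10.toL2 Ω (Y t)) y

/-- `y ∈ W(0,T)` with `f(y) ∈ L²(Q)` is a (weak) solution of
`∂ₜy - Δy + f(y) = u` in `Q`, `y = 0` on `∂Ω × (0,T)`, `y(·,0) = y₀` in `Ω`:
for almost every `t` the equation holds in `H⁻¹(Ω)`, and the continuous representative
`[0,T] → L²(Ω)` of `y` takes the value `y₀` at `t = 0`. -/
def IsSolution {n : ℕ} (Ω : Set (Euc n)) (T : ℝ) (f : ℝ → ℝ) (u : Euc n × ℝ → ℝ)
    (y₀ : Euc n → ℝ) (y : Euc n × ℝ → ℝ) : Prop :=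
  MemLp (fun p => f (y p)) 2 (volume.restrict (Cyl Ω T)) ∧
  ∃ (Y : ℝ → H10 Ω) (Y' : ℝ → HMinusOne Ω), IsW Ω T y Y Y' ∧
    (∀ᵐ t ∂(volume.restrict (Ioo 0 T)), ∀ v : H10 Ω,
      Y' t v + inner ℝ (Y t : Jet1 Ω).snd (v : Jet1 Ω).snd
        + ∫ x in Ω, f (y (x, t)) * H10.toL2 Ω v x
      = ∫ x in Ω, u (x, t) * H10.toL2 Ω v x) ∧
    ∃ Z : ℝ → L2 Ω, ContinuousOn Z (Icc 0 T) ∧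
      (∀ᵐ t ∂(volume.restrict (Ioo 0 T)), Z t = H10.toL2 Ω (Y t)) ∧
      Z 0 =ᵐ[volume.restrict Ω] y₀

/-- `y` is the state associated with the control `u`: the unique solution. -/
def IsState {n : ℕ} (Ω : Set (Euc n)) (T : ℝ) (f : ℝ → ℝ) (u : Euc n × ℝ → ℝ)
    (y₀ : Euc n → ℝ) (y : Euc n × ℝ → ℝ) : Prop :=
  IsSolution Ω T f u y₀ y ∧
    ∀ z, IsSolution Ω T f u y₀ z → z =ᵐ[volume.restrict (Cyl Ω T)] y

/-! ### The witness -/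

/-- A cut-off function `φ ∈ C_c^∞(ℝⁿ⁺¹)` with `0 ≤ φ ≤ 1`, `φ = 1` on `B₁(0) × [-1,1]` and
`φ = 0` outside `B₂(0) × [-2,2]`. -/
structure IsCutoff {n : ℕ} (φ : Euc n × ℝ → ℝ) : Prop where
  smooth : ContDiff ℝ ∞ φ
  compact : HasCompactSupport φ
  mem_Icc : ∀ p, φ p ∈ Icc (0 : ℝ) 1
  eq_one : ∀ p ∈ Metric.ball (0 : Euc n) 1 ×ˢ Icc (-1 : ℝ) 1, φ p = 1
  eq_zero : ∀ p ∉ Metric.ball (0 : Euc n) 2 ×ˢ Icc (-2 : ℝ) 2, φ p = 0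

/-- The `k`-th summand `k⁻¹ φ(2ᵏx, 2²ᵏ(t-1))`. -/
def term {n : ℕ} (φ : Euc n × ℝ → ℝ) (k : ℕ) (p : Euc n × ℝ) : ℝ :=
  (k : ℝ)⁻¹ * φ ((2 : ℝ) ^ k • p.1, (2 : ℝ) ^ (2 * k) * (p.2 - 1))

/-- `y(x,t) = ∑_{k=1}^∞ k⁻¹ φ(2ᵏx, 2²ᵏ(t-1))`; the sum is finite for `(x,t) ≠ (0,1)`. -/
def witness {n : ℕ} (φ : Euc n × ℝ → ℝ) (p : Euc n × ℝ) : ℝ :=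
  ∑' k : ℕ, term φ (k + 1) p

/-- `∂ₜy - Δy`, with classical derivatives. -/
def heat {n : ℕ} (y : Euc n × ℝ → ℝ) (p : Euc n × ℝ) : ℝ :=
  deriv (fun s => y (p.1, s)) p.2 - Laplacian.laplacian (fun x => y (x, p.2)) p.1

end ParabolicExample

end

open ParabolicExample

open MeasureTheory Set Filter Topology
open scoped ContDiff

namespace ParabolicExample

/-! ### Slices of square integrable functions -/

/-! Under parabolic scaling the k-th summand is at most 1/k, lives in a box of volume comparable to
2^{-k(n+2)}, and has time derivative and second space derivatives of size 2^{2k}/k. The boxes halve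
in space and quarter in time, so up to null sets the k-th box lies where all earlier cut-offs equal
1, and almost everywhere the series is locally a constant plus one single summand
(`series_eventuallyEq_const_add`). The squared L² norms of these derivatives are thus bounded by a
multiple of the sum of k^{-2} 2^{4k} 2^{-k(n+2)}, which converges because n ≥ 2
(`memLp_of_ae_eq_rescale`). Near the centre the series exceeds every harmonic partial sum, hence is
unbounded (`harmonic_le_series`); yet it grows at most linearly in k while the volumes decay
geometrically, so all its powers are in L² (`memLp_series_pow`).

Classical derivatives are weak ones because the singularity is a single point: all time slices but
one are test functions in space, and all space slices but one are test functions in time. Fubini and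
integration by parts on the slices then give the Bochner-space statements and the weak equation
(`IsRegularOff.isSolution`).

Uniqueness holds for every monotone nonlinearity (`IsSolution.ae_eq`). The equation for the
difference of two solutions is integrated in time and tested with increments of its own primitive;
Steklov averages replace the chain rule for the squared norm, and monotonicity gives the lower-order
term a sign (`eq_zero_of_energy`). -/

theorem measurable_of_measurable_dist {α E : Type*} [MeasurableSpace α] [PseudoMetricSpace E]
    [SecondCountableTopology E] [MeasurableSpace E] [BorelSpace E] {f : α → E}
    (h : ∀ c, Measurable fun a => dist (f a) c) : Measurable f := by
  refine measurable_of_isOpen fun U hU => ?_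
  rcases isEmpty_or_nonempty E with hE | hE
  · rw [show f ⁻¹' U = ∅ from eq_empty_of_forall_notMem fun a _ => hE.elim (f a)]
    exact MeasurableSet.empty
  -- An open set is the countable union of the balls inside it with rational radii about a dense
  -- sequence. A radius below `ε / 2` keeps such a ball inside the `ε`-ball of each of its points.
  have key : f ⁻¹' U = ⋃ (k : ℕ) (q : ℚ)
      (_ : Metric.ball (TopologicalSpace.denseSeq E k) (q : ℝ) ⊆ U),
      {a | dist (f a) (TopologicalSpace.denseSeq E k) < (q : ℝ)} := by
    ext a
    simp only [mem_preimage, mem_iUnion, mem_ofPred_eq, exists_prop]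
    constructor
    · intro ha
      obtain ⟨ε, hε, hb⟩ := Metric.isOpen_iff.1 hU _ ha
      obtain ⟨q, hq0, hq⟩ := exists_rat_btwn (half_pos hε)
      obtain ⟨k, hk⟩ := (TopologicalSpace.denseRange_denseSeq E).exists_dist_lt (f a) hq0
      refine ⟨k, q, fun z hz => hb ?_, hk⟩
      rw [Metric.mem_ball] at hz ⊢
      have := dist_triangle_right z (f a) (TopologicalSpace.denseSeq E k)
      linarith
    · rintro ⟨k, q, hb, ha⟩
      exact hb ha
  rw [key]
  exact MeasurableSet.iUnion fun k => MeasurableSet.iUnion fun q => MeasurableSet.iUnion fun _ =>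
    measurableSet_lt (h _) measurable_const

theorem lintegral_enorm_sq_eq {α : Type*} [MeasurableSpace α] {μ : Measure α} (f : α → ℝ) :
    ∫⁻ x, ‖f x‖ₑ ^ 2 ∂μ = eLpNorm f 2 μ ^ 2 := by
  rw [eLpNorm_eq_lintegral_rpow_enorm_toReal (by norm_num) (by norm_num), ← ENNReal.rpow_natCast,
    ← ENNReal.rpow_mul]
  simp

theorem memLp_two_iff_lintegral {α : Type*} [MeasurableSpace α] {μ : Measure α} {f : α → ℝ}
    (hf : AEStronglyMeasurable f μ) : MemLp f 2 μ ↔ ∫⁻ x, ‖f x‖ₑ ^ 2 ∂μ < ⊤ := by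
  rw [lintegral_enorm_sq_eq]
  constructor
  · intro h
    exact ENNReal.pow_lt_top h.2
  · intro h
    exact ⟨hf, by simpa using h⟩

/-- The difficulty is measurability of the `L²`-valued slice map. `L²` is separable here, so it
suffices that distances to fixed elements are measurable, and these are partial integrals covered by
Tonelli. -/
theorem exists_memLp_slice {α β : Type*} [MeasurableSpace α] [MeasurableSpace β]
    [MeasurableSpace.CountablyGenerated α] {μ : Measure α} [SFinite μ] {ν : Measure β} [SFinite ν]
    {F : α × β → ℝ} (hF : MemLp F 2 (μ.prod ν)) :
    ∃ Y : β → Lp ℝ 2 μ, MemLp Y 2 ν ∧ ∀ᵐ t ∂ν, Y t =ᵐ[μ] fun x => F (x, t) := by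
  classical
  obtain ⟨G, hG, hFG⟩ := hF.1
  have hG2 : MemLp G 2 (μ.prod ν) := hF.ae_eq hFG
  have hGs : ∀ t, AEStronglyMeasurable (fun x => G (x, t)) μ := fun t =>
    (hG.comp_measurable measurable_prodMk_right).aestronglyMeasurable
  -- The value 0 is taken on the measurable null set of times whose slice is not square integrable.
  let Y : β → Lp ℝ 2 μ := fun t =>
    if h : MemLp (fun x => G (x, t)) 2 μ then h.toLp else 0
  have hmeas : Measurable fun t => ∫⁻ x, ‖G (x, t)‖ₑ ^ 2 ∂μ :=
    Measurable.lintegral_prod_left' (hG.measurable.enorm.pow_const 2)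
  have hset : MeasurableSet {t | MemLp (fun x => G (x, t)) 2 μ} := by
    simp_rw [fun t => memLp_two_iff_lintegral (hGs t)]
    exact measurableSet_lt hmeas measurable_const
  have : Fact ((2 : ENNReal) ≠ ⊤) := ⟨by norm_num⟩
  borelize ↥(Lp ℝ 2 μ)
  have hYm : Measurable Y := by
    refine measurable_of_measurable_dist fun w => ?_
    have hw : Measurable fun t => ∫⁻ x, ‖G (x, t) - w x‖ₑ ^ 2 ∂μ :=
      Measurable.lintegral_prod_left'
        (((hG.sub ((Lp.stronglyMeasurable w).comp_measurable measurable_fst)).measurable.enorm).pow_const 2)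
    have hd : (fun t => dist (Y t) w) = fun t =>
        if MemLp (fun x => G (x, t)) 2 μ then
          ((∫⁻ x, ‖G (x, t) - w x‖ₑ ^ 2 ∂μ) ^ (1 / 2 : ℝ)).toReal else dist 0 w := by
      funext t
      by_cases h : MemLp (fun x => G (x, t)) 2 μ
      · simp only [Y, h, dif_pos, if_true]
        rw [Lp.dist_def, lintegral_enorm_sq_eq (fun x => G (x, t) - w x), ← ENNReal.rpow_natCast,
          ← ENNReal.rpow_mul]
        norm_num
        congr 1
        refine eLpNorm_congr_ae ?_
        filter_upwards [h.coeFn_toLp] with x hx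
        simp [hx]
      · simp only [Y, h, dif_neg, not_false_eq_true, if_false]
    rw [hd]
    exact Measurable.ite hset (hw.pow_const _).ennreal_toReal measurable_const
  have hY : ∀ t, MemLp (fun x => G (x, t)) 2 μ → Y t =ᵐ[μ] fun x => G (x, t) := by
    intro t h
    simp only [Y, h, dif_pos]
    exact h.coeFn_toLp
  have hint : ∫⁻ t, ∫⁻ x, ‖G (x, t)‖ₑ ^ 2 ∂μ ∂ν < ⊤ := by
    rw [← lintegral_prod_symm' _ (hG.measurable.enorm.pow_const 2)]
    exact (memLp_two_iff_lintegral hG2.1).1 hG2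
  have hae : ∀ᵐ t ∂ν, MemLp (fun x => G (x, t)) 2 μ := by
    filter_upwards [ae_lt_top hmeas hint.ne] with t ht
    exact (memLp_two_iff_lintegral (hGs t)).2 ht
  refine ⟨Y, ?_, ?_⟩
  · refine (memLp_norm_iff hYm.aestronglyMeasurable).1 ?_
    rw [memLp_two_iff_lintegral hYm.norm.aestronglyMeasurable]
    refine lt_of_le_of_lt (le_of_eq (lintegral_congr_ae ?_)) hint
    filter_upwards [hae] with t ht
    have h1 : ∫⁻ x, ‖G (x, t)‖ₑ ^ 2 ∂μ = ∫⁻ x, ‖Y t x‖ₑ ^ 2 ∂μ := by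
      refine lintegral_congr_ae ?_
      filter_upwards [hY t ht] with x hx
      rw [hx]
    rw [h1, lintegral_enorm_sq_eq, enorm_norm, Lp.enorm_def]
  · have h2 : ∀ᵐ t ∂ν, ∀ᵐ x ∂μ, F (x, t) = G (x, t) := by
      have := Measure.ae_ae_of_ae_prod
        ((Measure.measurePreserving_swap (μ := ν) (ν := μ)).quasiMeasurePreserving.ae hFG)
      simpa using this
    filter_upwards [hae, h2] with t ht h2
    exact (hY t ht).trans (EventuallyEq.symm h2)

theorem ae_eq_prod_of_ae_ae_swap {α β : Type*} [MeasurableSpace α] [MeasurableSpace β]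
    {μ : Measure α} [SFinite μ] {ν : Measure β} [SFinite ν] {F G : α × β → ℝ}
    (hF : AEStronglyMeasurable F (μ.prod ν)) (hG : AEStronglyMeasurable G (μ.prod ν))
    (h : ∀ᵐ t ∂ν, ∀ᵐ x ∂μ, F (x, t) = G (x, t)) : F =ᵐ[μ.prod ν] G := by
  have hm : AEMeasurable (fun p => ‖F p - G p‖ₑ) (μ.prod ν) := (hF.sub hG).enorm
  have h0 : ∫⁻ p, ‖F p - G p‖ₑ ∂(μ.prod ν) = 0 := by
    rw [lintegral_prod_symm _ hm]
    refine (lintegral_congr_ae ?_).trans (lintegral_zero (μ := ν))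
    filter_upwards [h] with t ht
    refine (lintegral_congr_ae ?_).trans (lintegral_zero (μ := μ))
    filter_upwards [ht] with x hx
    simp [hx]
  filter_upwards [(lintegral_eq_zero_iff' hm).1 h0] with p hp
  simpa [sub_eq_zero] using hp

theorem restrict_cyl {n : ℕ} (Ω : Set (Euc n)) (T : ℝ) :
    (volume.restrict (Cyl Ω T) : Measure (Euc n × ℝ)) =
      (volume.restrict Ω).prod (volume.restrict (Ioo 0 T)) := by
  rw [Measure.prod_restrict]; rfl

theorem exists_represents {n : ℕ} {Ω : Set (Euc n)} {T : ℝ} {F : Euc n × ℝ → ℝ}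
    (hF : MemLp F 2 (volume.restrict (Cyl Ω T))) :
    ∃ Y : ℝ → L2 Ω, MemL2Time T Y ∧ Represents Ω T Y F := by
  rw [restrict_cyl] at hF
  exact exists_memLp_slice hF

theorem integrableOn_of_memL2Time {X : Type*} [NormedAddCommGroup X] {T : ℝ} {Y : ℝ → X}
    (h : MemL2Time T Y) : IntegrableOn Y (Ioo 0 T) :=
  MemLp.integrable (by norm_num) h

/-! ### Functions with an integrable weak time derivative -/

theorem IsTest.eq_zero {V : Type*} [NormedAddCommGroup V] [NormedSpace ℝ V] {U : Set V}
    {φ : V → ℝ} (h : IsTest U φ) {x : V} (hx : x ∉ U) : φ x = 0 :=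
  image_eq_zero_of_notMem_tsupport fun h' => hx (h.2.2 h')

theorem exists_Icc_of_isCompact_subset_Ioo {K : Set ℝ} {T : ℝ} (hT : 0 < T) (hK : IsCompact K)
    (hKT : K ⊆ Ioo 0 T) : ∃ a b, 0 < a ∧ b < T ∧ a ≤ b ∧ K ⊆ Icc a b := by
  rcases K.eq_empty_or_nonempty with rfl | hne
  · exact ⟨T / 2, T / 2, by linarith, by linarith, le_rfl, empty_subset _⟩
  · obtain ⟨a, ha⟩ := hK.exists_isLeast hne
    obtain ⟨b, hb⟩ := hK.exists_isGreatest hne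
    exact ⟨a, b, (hKT ha.1).1, (hKT hb.1).2, ha.2 hb.1, fun x hx => ⟨ha.2 hx, hb.2 hx⟩⟩

/-- To the right of the support the primitive equals the full integral, which is zero; so the
primitive is again compactly supported in the interval. -/
theorem IsTest.exists_primitive {T : ℝ} (hT : 0 < T) {χ : ℝ → ℝ} (h : IsTest (Ioo 0 T) χ)
    (h0 : ∫ t, χ t = 0) : ∃ ψ, IsTest (Ioo 0 T) ψ ∧ deriv ψ = χ := by
  obtain ⟨a, b, ha, hb, hab, hK⟩ := exists_Icc_of_isCompact_subset_Ioo hT h.2.1.isCompact h.2.2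
  have hz : ∀ t ∉ Icc a b, χ t = 0 := fun t ht =>
    image_eq_zero_of_notMem_tsupport fun h' => ht (hK h')
  have hc : Continuous χ := h.1.continuous
  let ψ : ℝ → ℝ := fun t => ∫ s in (0:ℝ)..t, χ s
  have hd : deriv ψ = χ := by
    funext t
    exact Continuous.deriv_integral χ hc 0 t
  have hψ0 : ∀ t ∉ Icc a b, ψ t = 0 := by
    intro t ht
    rcases lt_or_ge t a with hta | hta
    · refine intervalIntegral.integral_zero_ae (ae_of_all _ fun s hs => hz s fun hs' => ?_)
      have h1 : s ≤ max 0 t := hs.2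
      exact absurd (hs'.1.trans h1) (not_le.2 (max_lt ha hta))
    · have hbt : b < t := by
        by_contra h1
        exact ht ⟨hta, not_lt.1 h1⟩
      have : ψ t = ∫ s in Ioc 0 t, χ s :=
        intervalIntegral.integral_of_le (ha.le.trans hta)
      rw [this, ← integral_Icc_eq_integral_Ioc]
      refine (setIntegral_eq_integral_of_forall_compl_eq_zero fun s hs =>
        hz s fun hs' => hs ?_).trans h0
      exact ⟨ha.le.trans hs'.1, hs'.2.trans hbt.le⟩
  have hts : tsupport ψ ⊆ Icc a b := by
    refine closure_minimal (fun t ht => ?_) isClosed_Icc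
    by_contra h1
    exact ht (hψ0 t h1)
  refine ⟨ψ, ⟨?_, ?_, ?_⟩, hd⟩
  · rw [contDiff_infty_iff_deriv, hd]
    exact ⟨fun t => (hc.integral_hasStrictDerivAt 0 t).hasDerivAt.differentiableAt, h.1⟩
  · exact HasCompactSupport.of_support_subset_isCompact isCompact_Icc (subset_closure.trans hts)
  · exact hts.trans fun t ht => ⟨ha.trans_le ht.1, ht.2.trans_lt hb⟩

theorem exists_isTest_integral_eq_one {T : ℝ} (hT : 0 < T) :
    ∃ ρ : ℝ → ℝ, IsTest (Ioo 0 T) ρ ∧ ∫ t, ρ t = 1 := by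
  let f : ContDiffBump (T / 2) := ⟨T / 8, T / 4, by linarith, by linarith⟩
  refine ⟨f.normed volume, ⟨f.contDiff_normed, f.hasCompactSupport_normed, ?_⟩, f.integral_normed⟩
  rw [f.tsupport_normed_eq, Real.closedBall_eq_Icc]
  intro t ht
  simp only [f] at ht
  exact ⟨by linarith [ht.1], by linarith [ht.2]⟩

variable {E : Type*} [NormedAddCommGroup E] [NormedSpace ℝ E]

theorem IsTest.integrableOn_smul {T : ℝ} {ψ : ℝ → ℝ} (hψ : IsTest (Ioo 0 T) ψ) {R : ℝ → E}
    (hR : IntegrableOn R (Ioo 0 T)) : IntegrableOn (fun t => ψ t • R t) (Ioo 0 T) := by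
  obtain ⟨C, hC⟩ := hψ.2.1.exists_bound_of_continuous hψ.1.continuous
  exact hR.bdd_smul C hψ.1.continuous.aestronglyMeasurable (ae_of_all _ hC)

theorem IsTest.deriv_isTest {T : ℝ} {ψ : ℝ → ℝ} (hψ : IsTest (Ioo 0 T) ψ) :
    IsTest (Ioo 0 T) (deriv ψ) :=
  ⟨(contDiff_infty_iff_deriv.1 hψ.1).2, hψ.2.1.deriv,
    (closure_minimal (support_deriv_subset (f := ψ)) (isClosed_tsupport ψ)).trans hψ.2.2⟩

/-- Fubini on the triangle `s < t`: the inner integral of `deriv ψ` over `(s, T)` is `-ψ s`. No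
differentiability of the primitive of `R` is used. -/
theorem IsTest.integral_deriv_smul_primitive [CompleteSpace E] {T : ℝ} {ψ : ℝ → ℝ}
    (hψ : IsTest (Ioo 0 T) ψ) {R : ℝ → E} (hR : IntegrableOn R (Ioo 0 T)) :
    ∫ t in Ioo 0 T, deriv ψ t • (∫ s in (0:ℝ)..t, R s) = -∫ t in Ioo 0 T, ψ t • R t := by
  set μ : Measure ℝ := volume.restrict (Ioo 0 T)
  have hd : Continuous (deriv ψ) := hψ.deriv_isTest.1.continuous
  have hdi : Integrable (deriv ψ) μ :=
    (hd.integrable_of_hasCompactSupport hψ.deriv_isTest.2.1).integrableOn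
  have hint : Integrable (fun p : ℝ × ℝ => {p : ℝ × ℝ | p.2 < p.1}.indicator
      (fun p => deriv ψ p.1 • R p.2) p) (μ.prod μ) :=
    (hdi.smul_prod hR).indicator (measurableSet_lt measurable_snd measurable_fst)
  have hswap := integral_integral_swap (f := fun t s => {p : ℝ × ℝ | p.2 < p.1}.indicator
      (fun p => deriv ψ p.1 • R p.2) (t, s)) hint
  have h1 : ∀ t ∈ Ioo 0 T, ∫ s, {p : ℝ × ℝ | p.2 < p.1}.indicator
      (fun p => deriv ψ p.1 • R p.2) (t, s) ∂μ = deriv ψ t • (∫ s in (0:ℝ)..t, R s) := by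
    intro t ht
    have : (fun s => {p : ℝ × ℝ | p.2 < p.1}.indicator
      (fun p => deriv ψ p.1 • R p.2) (t, s)) =
        (Iio t).indicator fun s => deriv ψ t • R s := by
      funext s
      simp [indicator]
    rw [this, integral_indicator measurableSet_Iio, integral_smul,
      intervalIntegral.integral_of_le ht.1.le,
      Measure.restrict_restrict measurableSet_Iio, integral_Ioc_eq_integral_Ioo]
    congr 3
    ext s
    constructor
    · rintro ⟨h1, h2⟩
      exact ⟨h2.1, h1⟩
    · rintro ⟨h1, h2⟩
      exact ⟨h2, h1, h2.trans ht.2⟩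
  have h2 : ∀ s ∈ Ioo 0 T, ∫ t, {p : ℝ × ℝ | p.2 < p.1}.indicator
      (fun p => deriv ψ p.1 • R p.2) (t, s) ∂μ = -(ψ s • R s) := by
    intro s hs
    have : (fun t => {p : ℝ × ℝ | p.2 < p.1}.indicator
      (fun p => deriv ψ p.1 • R p.2) (t, s)) =
        (Ioi s).indicator fun t => deriv ψ t • R s := by
      funext t
      simp [indicator]
    rw [this, integral_indicator measurableSet_Ioi, integral_smul_const,
      Measure.restrict_restrict measurableSet_Ioi]
    have h3 : Ioi s ∩ Ioo 0 T = Ioo s T := by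
      ext t
      constructor
      · rintro ⟨h1, h2⟩
        exact ⟨h1, h2.2⟩
      · rintro ⟨h1, h2⟩
        exact ⟨h1, hs.1.trans h1, h2⟩
    rw [h3, ← integral_Ioc_eq_integral_Ioo, ← intervalIntegral.integral_of_le hs.2.le,
      intervalIntegral.integral_deriv_eq_sub
        (fun x _ => (hψ.1.differentiable (by norm_num)).differentiableAt)
        (hd.intervalIntegrable _ _), hψ.eq_zero (x := T) (by simp)]
    simp
  rw [← integral_neg, ← setIntegral_congr_fun measurableSet_Ioo (fun t ht => h1 t ht),
    ← setIntegral_congr_fun measurableSet_Ioo (fun t ht => h2 t ht)]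
  exact hswap

/-- The du Bois-Reymond lemma. Subtracting from a test function its mean times a fixed unit-mass
bump `ρ` makes it the derivative of a test function, which identifies the constant as the
`ρ`-average of `R`. -/
theorem ae_eq_const_of_integral_deriv_smul [CompleteSpace E] {T : ℝ} (hT : 0 < T) {R : ℝ → E}
    (hR : IntegrableOn R (Ioo 0 T))
    (h : ∀ ψ : ℝ → ℝ, IsTest (Ioo 0 T) ψ → ∫ t in Ioo 0 T, deriv ψ t • R t = 0) :
    ∃ c, ∀ᵐ t ∂(volume.restrict (Ioo 0 T)), R t = c := by
  obtain ⟨ρ, hρ, hρ1⟩ := exists_isTest_integral_eq_one hT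
  refine ⟨∫ t in Ioo 0 T, ρ t • R t, ?_⟩
  set c := ∫ t in Ioo 0 T, ρ t • R t
  have hci : IntegrableOn (fun _ : ℝ => c) (Ioo 0 T) := integrableOn_const (by simp)
  have := isOpen_Ioo.ae_eq_zero_of_integral_contDiff_smul_eq_zero (μ := (volume : Measure ℝ))
    (f := fun t => R t - c) (hR.sub hci).locallyIntegrableOn ?_
  · rw [ae_restrict_iff' measurableSet_Ioo]
    filter_upwards [this] with t ht h1
    exact sub_eq_zero.1 (ht h1)
  · intro χ hχ1 hχ2 hχ3
    have hχ : IsTest (Ioo 0 T) χ := ⟨hχ1, hχ2, hχ3⟩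
    have hχi : Integrable χ := hχ1.continuous.integrable_of_hasCompactSupport hχ2
    have hρi : Integrable ρ := hρ.1.continuous.integrable_of_hasCompactSupport hρ.2.1
    set m := ∫ t, χ t
    have htest : IsTest (Ioo 0 T) fun t => χ t - m * ρ t := by
      refine ⟨hχ1.sub (contDiff_const.mul hρ.1), hχ2.sub hρ.2.1.mul_left, ?_⟩
      exact (tsupport_sub _ _).trans (union_subset hχ3 ((tsupport_mul_subset_right).trans hρ.2.2))
    obtain ⟨ψ, hψ, hψd⟩ := htest.exists_primitive hT (by
      rw [integral_sub hχi (hρi.const_mul m), integral_const_mul, hρ1]; simp [m])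
    have h1 := h ψ hψ
    rw [hψd] at h1
    have hset : ∫ t, χ t • (R t - c) = ∫ t in Ioo 0 T, χ t • (R t - c) :=
      (setIntegral_eq_integral_of_forall_compl_eq_zero fun t ht => by
        rw [hχ.eq_zero ht, zero_smul]).symm
    have hm : ∫ t in Ioo 0 T, χ t = m :=
      setIntegral_eq_integral_of_forall_compl_eq_zero fun t ht => hχ.eq_zero ht
    have i1 := hχ.integrableOn_smul hR
    have i2 := hρ.integrableOn_smul hR
    rw [hset]
    simp_rw [smul_sub]
    rw [integral_sub i1 (hχ.integrableOn_smul hci), integral_smul_const, hm]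
    simp_rw [sub_smul, mul_smul] at h1
    have i3 : IntegrableOn (fun t => m • ρ t • R t) (Ioo 0 T) := i2.smul m
    rw [integral_sub i1 i3, integral_smul] at h1
    exact h1

theorem HasWeakTimeDeriv.exists_ae_eq_primitive [CompleteSpace E] {T : ℝ} (hT : 0 < T)
    {Y Y' : ℝ → E} (hY : IntegrableOn Y (Ioo 0 T)) (hY' : IntegrableOn Y' (Ioo 0 T))
    (h : HasWeakTimeDeriv T Y Y') :
    ∃ c, ∀ᵐ t ∂(volume.restrict (Ioo 0 T)), Y t = c + ∫ s in (0:ℝ)..t, Y' s := by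
  have hii : IntervalIntegrable Y' volume 0 T :=
    (intervalIntegrable_iff_integrableOn_Ioo_of_le hT.le).2 hY'
  have hBc : ContinuousOn (fun t => ∫ s in (0:ℝ)..t, Y' s) (Icc 0 T) := by
    have := intervalIntegral.continuousOn_primitive_interval' hii left_mem_uIcc
    rwa [uIcc_of_le hT.le] at this
  have hB : IntegrableOn (fun t => ∫ s in (0:ℝ)..t, Y' s) (Ioo 0 T) :=
    (hBc.integrableOn_compact isCompact_Icc).mono_set Ioo_subset_Icc_self
  obtain ⟨c, hc⟩ := ae_eq_const_of_integral_deriv_smul hT (hY.sub hB) (fun ψ hψ => by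
    simp_rw [Pi.sub_apply, smul_sub]
    rw [integral_sub (hψ.deriv_isTest.integrableOn_smul hY) (hψ.deriv_isTest.integrableOn_smul hB),
      h ψ hψ,
      hψ.integral_deriv_smul_primitive hY', sub_self])
  refine ⟨c, ?_⟩
  filter_upwards [hc] with t ht
  rw [← ht]
  simp

/-! ### Steklov averages and the energy argument -/

section Translation
variable {E : Type*} [NormedAddCommGroup E]

/-- Continuity of translations in L¹, obtained from continuous dependence of composition with
measure preserving maps on the map; currying makes the translations a continuous family. -/
theorem tendsto_lintegral_enorm_translate_sub {g : ℝ → E} (hg : Integrable g) :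
    Tendsto (fun r : ℝ => ∫⁻ s, ‖g (s + r) - g s‖ₑ) (𝓝 0) (𝓝 0) := by
  have hg1 : MemLp g 1 volume := memLp_one_iff_integrable.2 hg
  let F : C(ℝ, C(ℝ, ℝ)) := (ContinuousMap.mk (fun a : ℝ × ℝ => a.2 + a.1) (by fun_prop)).curry
  have hF : ∀ r, MeasurePreserving (F r) volume volume := fun r =>
    measurePreserving_add_right volume r
  have ht := Filter.Tendsto.compMeasurePreservingLp (l := 𝓝 (0 : ℝ)) (p := 1)
    (tendsto_const_nhds (x := hg1.toLp g)) (F.continuous.tendsto 0) hF (hF 0) (by norm_num)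
  have ht' := (tendsto_iff_edist_tendsto_0).1 ht
  refine ht'.congr fun r => ?_
  rw [Lp.edist_def, eLpNorm_one_eq_lintegral_enorm]
  refine lintegral_congr_ae ?_
  filter_upwards [Lp.coeFn_compMeasurePreserving (hg1.toLp g) (hF r),
    Lp.coeFn_compMeasurePreserving (hg1.toLp g) (hF 0), hg1.coeFn_toLp,
    (hF r).quasiMeasurePreserving.ae hg1.coeFn_toLp] with s h1 h2 h3 h4
  have e0 : (F 0) s = s := add_zero s
  have e1 : (F r) s = s + r := rfl
  simp only [Pi.sub_apply, h1, h2, Function.comp_apply, e0, h3]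
  rw [h4, e1]

variable [NormedSpace ℝ E]

theorem tendsto_lintegral_enorm_average_sub [CompleteSpace E] {g : ℝ → E} (hg : Integrable g) :
    Tendsto (fun h : ℝ => ∫⁻ s, ‖h⁻¹ • (∫ r in s..(s + h), g r) - g s‖ₑ) (𝓝[>] 0) (𝓝 0) := by
  -- Tonelli below needs `g (s + r)` to be jointly measurable in `(s, r)`.
  wlog hsm : StronglyMeasurable g generalizing g
  · have hae := hg.1.ae_eq_mk
    refine (this (hg.congr hae) hg.1.stronglyMeasurable_mk).congr fun h => ?_
    refine lintegral_congr_ae ?_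
    filter_upwards [hae] with s hs
    rw [hs, intervalIntegral.integral_congr_ae (hae.mono fun x hx _ => hx)]
  have hτ := tendsto_lintegral_enorm_translate_sub hg
  rw [ENNReal.tendsto_nhds_zero] at hτ ⊢
  intro ε hε
  obtain ⟨δ, hδ, hb⟩ := Metric.eventually_nhds_iff.1 (hτ ε hε)
  filter_upwards [Ioo_mem_nhdsGT hδ] with h hh
  have hh0 : 0 < h := hh.1
  -- The error of the average is the average over `r` in `(0, h)` of the translation errors, each
  -- small in L¹.
  have hpt : ∀ s, ‖h⁻¹ • (∫ r in s..(s + h), g r) - g s‖ₑ ≤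
      ENNReal.ofReal h⁻¹ * ∫⁻ r in Ioc 0 h, ‖g (s + r) - g s‖ₑ := by
    intro s
    have hi : IntervalIntegrable (fun r => g (s + r)) volume 0 h :=
      (hg.comp_add_left s).intervalIntegrable
    have e1 : h⁻¹ • (∫ r in s..(s + h), g r) - g s = h⁻¹ • ∫ r in (0:ℝ)..h, (g (s + r) - g s) := by
      rw [intervalIntegral.integral_sub hi intervalIntegrable_const,
        intervalIntegral.integral_comp_add_left (fun r => g r) s, intervalIntegral.integral_const,
        smul_sub, smul_smul]
      simp [hh0.ne']
    rw [e1, enorm_smul, intervalIntegral.integral_of_le hh0.le,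
      Real.enorm_of_nonneg (inv_nonneg.2 hh0.le)]
    gcongr
    exact enorm_integral_le_lintegral_enorm _
  have hmeas : Measurable fun p : ℝ × ℝ => ‖g (p.1 + p.2) - g p.1‖ₑ :=
    ((hsm.comp_measurable (measurable_fst.add measurable_snd)).sub
      (hsm.comp_measurable measurable_fst)).enorm
  calc ∫⁻ s, ‖h⁻¹ • (∫ r in s..(s + h), g r) - g s‖ₑ
      ≤ ∫⁻ s, ENNReal.ofReal h⁻¹ * ∫⁻ r in Ioc 0 h, ‖g (s + r) - g s‖ₑ := lintegral_mono hpt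
    _ = ENNReal.ofReal h⁻¹ * ∫⁻ s, ∫⁻ r in Ioc 0 h, ‖g (s + r) - g s‖ₑ := by
        rw [lintegral_const_mul _ (Measurable.lintegral_prod_right' hmeas)]
    _ = ENNReal.ofReal h⁻¹ * ∫⁻ r in Ioc 0 h, ∫⁻ s, ‖g (s + r) - g s‖ₑ := by
        rw [lintegral_lintegral_swap hmeas.aemeasurable]
    _ ≤ ENNReal.ofReal h⁻¹ * ∫⁻ r in Ioc 0 h, ε := by
        refine mul_le_mul_right ?_ _
        refine setLIntegral_mono measurable_const fun r hr => hb ?_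
        rw [Real.dist_eq, sub_zero, abs_of_pos hr.1]
        exact hr.2.trans_lt hh.2
    _ = ε := by
        rw [setLIntegral_const, Real.volume_Ioc, sub_zero, mul_comm ε, ← mul_assoc,
          ← ENNReal.ofReal_mul (inv_nonneg.2 hh0.le), inv_mul_cancel₀ hh0.ne']
        simp

end Translation

section Energy
variable {V H K : Type*} [NormedAddCommGroup V] [NormedSpace ℝ V] [CompleteSpace V]
  [NormedAddCommGroup H] [InnerProductSpace ℝ H] [CompleteSpace H]
  [NormedAddCommGroup K] [InnerProductSpace ℝ K]

/-- The averages of `g` converge only in L¹, those of `Z` pointwise and boundedly. Splitting off the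
error of `g` leaves one limit by dominated convergence and one remainder of the form L¹ times
bounded. -/
theorem tendsto_integral_inner_average {g Z : ℝ → H} (hg : Integrable g) (hZ : Continuous Z)
    {M : ℝ} (hM : ∀ t, ‖Z t‖ ≤ M) (t₀ : ℝ) :
    Tendsto (fun h : ℝ => ∫ s in Ioc 0 t₀, inner ℝ (h⁻¹ • ∫ r in s..(s + h), g r)
      (h⁻¹ • ∫ r in s..(s + h), Z r)) (𝓝[>] 0) (𝓝 (∫ s in Ioc 0 t₀, inner ℝ (g s) (Z s))) := by
  have hM0 : 0 ≤ M := (norm_nonneg _).trans (hM 0)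
  have hgc : Continuous fun s => ∫ r in (0:ℝ)..s, g r :=
    intervalIntegral.continuous_primitive (fun a b => hg.intervalIntegrable) 0
  have hZc : Continuous fun s => ∫ r in (0:ℝ)..s, Z r :=
    intervalIntegral.continuous_primitive (fun a b => hZ.intervalIntegrable _ _) 0
  have hgd : ∀ s h, ∫ r in s..(s + h), g r = (∫ r in (0:ℝ)..(s + h), g r) - ∫ r in (0:ℝ)..s, g r :=
    fun s h => (intervalIntegral.integral_interval_sub_left hg.intervalIntegrable
      hg.intervalIntegrable).symm
  have hZd : ∀ s h, ∫ r in s..(s + h), Z r = (∫ r in (0:ℝ)..(s + h), Z r) - ∫ r in (0:ℝ)..s, Z r :=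
    fun s h => (intervalIntegral.integral_interval_sub_left (hZ.intervalIntegrable _ _)
      (hZ.intervalIntegrable _ _)).symm
  have hpc : ∀ h : ℝ, Continuous fun s => h⁻¹ • ∫ r in s..(s + h), Z r := by
    intro h
    simp_rw [hZd]
    exact ((hZc.comp (continuous_id.add continuous_const)).sub hZc).const_smul _
  have hac : ∀ h : ℝ, Continuous fun s => h⁻¹ • ∫ r in s..(s + h), g r := by
    intro h
    simp_rw [hgd]
    exact ((hgc.comp (continuous_id.add continuous_const)).sub hgc).const_smul _
  have hpM : ∀ h : ℝ, 0 < h → ∀ s, ‖h⁻¹ • ∫ r in s..(s + h), Z r‖ ≤ M := by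
    intro h hh s
    rw [norm_smul, norm_inv, Real.norm_of_nonneg hh.le]
    have := intervalIntegral.norm_integral_le_of_norm_le_const (a := s) (b := s + h) (C := M)
      (f := Z) fun x _ => hM x
    rw [add_sub_cancel_left, abs_of_pos hh] at this
    calc h⁻¹ * ‖∫ r in s..(s + h), Z r‖ ≤ h⁻¹ * (M * h) := by gcongr
      _ = M := by field_simp
  have hlim : ∀ s, Tendsto (fun h : ℝ => h⁻¹ • ∫ r in s..(s + h), Z r) (𝓝[>] 0) (𝓝 (Z s)) := by
    intro s
    have h1 : HasDerivAt (fun s => ∫ r in (0:ℝ)..s, Z r) (Z s) s :=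
      (hZ.integral_hasStrictDerivAt 0 s).hasDerivAt
    simp_rw [hZd]
    exact h1.tendsto_slope_zero_right
  have hA : Tendsto (fun h : ℝ => ∫ s in Ioc 0 t₀, inner ℝ (g s)
      (h⁻¹ • ∫ r in s..(s + h), Z r)) (𝓝[>] 0) (𝓝 (∫ s in Ioc 0 t₀, inner ℝ (g s) (Z s))) := by
    refine tendsto_integral_filter_of_dominated_convergence (fun s => ‖g s‖ * M) ?_ ?_ ?_ ?_
    · exact Eventually.of_forall fun h =>
        hg.1.restrict.inner (hpc h).aestronglyMeasurable
    · filter_upwards [self_mem_nhdsWithin] with h hh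
      refine ae_of_all _ fun s => (norm_inner_le_norm _ _).trans ?_
      gcongr
      exact hpM h hh s
    · exact (hg.norm.mul_const M).integrableOn
    · exact ae_of_all _ fun s => tendsto_const_nhds.inner (hlim s)
  have hB : Tendsto (fun h : ℝ => ∫ s in Ioc 0 t₀, inner ℝ (h⁻¹ • (∫ r in s..(s + h), g r) - g s)
      (h⁻¹ • ∫ r in s..(s + h), Z r)) (𝓝[>] 0) (𝓝 0) := by
    have h1 := (ENNReal.tendsto_toReal (by simp)).comp
      (ENNReal.Tendsto.const_mul (a := ENNReal.ofReal M) (tendsto_lintegral_enorm_average_sub hg)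
        (Or.inr (by simp)))
    rw [mul_zero, ENNReal.toReal_zero] at h1
    have hfin : ∀ᶠ h in 𝓝[>] (0:ℝ),
        ∫⁻ s, ‖h⁻¹ • (∫ r in s..(s + h), g r) - g s‖ₑ < ⊤ :=
      (tendsto_lintegral_enorm_average_sub hg).eventually (gt_mem_nhds (by simp))
    refine squeeze_zero_norm' ?_ h1
    filter_upwards [self_mem_nhdsWithin, hfin] with h hh hf
    rw [Function.comp_apply, ← ENNReal.ofReal_le_iff_le_toReal
      (ENNReal.mul_ne_top (by simp) hf.ne), ofReal_norm]
    refine (enorm_integral_le_lintegral_enorm _).trans ?_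
    refine (setLIntegral_le_lintegral _ _).trans ?_
    rw [← lintegral_const_mul' _ _ (by simp)]
    refine lintegral_mono fun s => ?_
    rw [mul_comm, ← ofReal_norm, ← ofReal_norm, ← ENNReal.ofReal_mul (norm_nonneg _)]
    refine ENNReal.ofReal_le_ofReal ((norm_inner_le_norm _ _).trans ?_)
    gcongr
    exact hpM h hh s
  have hAB := hA.add hB
  rw [add_zero] at hAB
  refine hAB.congr' ?_
  filter_upwards [self_mem_nhdsWithin] with h hh
  have hbd : ∀ f : ℝ → H, IntegrableOn f (Ioc 0 t₀) → IntegrableOn (fun s => inner ℝ (f s)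
      (h⁻¹ • ∫ r in s..(s + h), Z r)) (Ioc 0 t₀) := by
    intro f hf
    refine Integrable.mono' (hf.norm.mul_const M) (hf.1.inner (hpc h).aestronglyMeasurable)
      (ae_of_all _ fun s => (norm_inner_le_norm _ _).trans ?_)
    gcongr
    exact hpM h hh s
  have hgi : IntegrableOn g (Ioc 0 t₀) := hg.integrableOn
  have hai : IntegrableOn (fun s => h⁻¹ • (∫ r in s..(s + h), g r)) (Ioc 0 t₀) :=
    ((hac h).integrableOn_Icc).mono_set Ioc_subset_Icc_self
  have hsi : IntegrableOn (fun s => h⁻¹ • (∫ r in s..(s + h), g r) - g s) (Ioc 0 t₀) := hai.sub hgi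
  rw [← integral_add (hbd g hgi) (hbd _ hsi)]
  refine integral_congr_ae (ae_of_all _ fun s => ?_)
  simp only [← inner_add_left]
  congr 1
  simp

/-- The energy inequality in time-integrated form. The averaged squared norm is differentiable for
each step `h`, so no chain rule for `‖Z‖ ^ 2` is required; letting `h` tend to zero gives half of
`‖Z t₀‖ ^ 2` at most minus the integral of a nonnegative function. -/
theorem eq_zero_of_energy (ι : V →L[ℝ] H) (γ : V →L[ℝ] K) {T : ℝ} {D : ℝ → V} {Z g : ℝ → H}
    (hD : IntegrableOn D (Ioo 0 T)) (hZ : ContinuousOn Z (Icc 0 T)) (hZ0 : Z 0 = 0)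
    (hDZ : ∀ᵐ t ∂(volume.restrict (Ioo 0 T)), Z t = ι (D t))
    (hg : IntegrableOn g (Ioo 0 T))
    (hpos : ∀ᵐ t ∂(volume.restrict (Ioo 0 T)), 0 ≤ inner ℝ (g t) (Z t))
    (heq : ∀ t ∈ Icc 0 T, ∀ v, inner ℝ (Z t) (ι v) + inner ℝ (γ (∫ s in (0:ℝ)..t, D s)) (γ v) +
      inner ℝ (∫ s in (0:ℝ)..t, g s) (ι v) = 0) {t₀ : ℝ} (ht₀ : t₀ ∈ Ioo 0 T) : Z t₀ = 0 := by
  have hT : 0 ≤ T := (ht₀.1.trans ht₀.2).le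
  let W : ℝ → H := IccExtend hT ((Icc 0 T).domRestrict Z)
  have hW : Continuous W := (continuousOn_iff_continuous_domRestrict.1 hZ).Icc_extend'
  have hWZ : ∀ t ∈ Icc 0 T, W t = Z t := fun t ht => IccExtend_of_mem hT _ ht
  obtain ⟨M, hM⟩ : ∃ M, ∀ t, ‖W t‖ ≤ M := by
    obtain ⟨M, hM⟩ := isCompact_Icc.exists_bound_of_continuousOn hZ
    exact ⟨M, fun t => hM _ (projIcc 0 T hT t).2⟩
  let gh : ℝ → H := (Ioo 0 T).indicator g
  have hgh : Integrable gh := (integrable_indicator_iff measurableSet_Ioo).2 hg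
  have hDI : IntervalIntegrable D volume 0 T :=
    (intervalIntegrable_iff_integrableOn_Ioo_of_le hT).2 hD
  have hsub : ∀ {t}, t ∈ Icc 0 T → uIcc 0 t ⊆ uIcc 0 T := fun {t} ht => by
    rw [uIcc_of_le ht.1, uIcc_of_le hT]
    exact Icc_subset_Icc_right ht.2
  have hgG : ∀ t ∈ Icc 0 T, ∫ s in (0:ℝ)..t, gh s = ∫ s in (0:ℝ)..t, g s := by
    intro t ht
    rw [intervalIntegral.integral_of_le ht.1, intervalIntegral.integral_of_le ht.1,
      integral_Ioc_eq_integral_Ioo, integral_Ioc_eq_integral_Ioo]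
    refine setIntegral_congr_fun measurableSet_Ioo fun s hs => ?_
    exact indicator_of_mem (show s ∈ Ioo 0 T from ⟨hs.1, hs.2.trans_le ht.2⟩) g
  have hm : ∀ t ∈ Icc 0 T, ∫ s in (0:ℝ)..t, W s = ι (∫ s in (0:ℝ)..t, D s) := by
    intro t ht
    rw [← ContinuousLinearMap.intervalIntegral_comp_comm ι (hDI.mono_set (hsub ht)),
      intervalIntegral.integral_of_le ht.1, intervalIntegral.integral_of_le ht.1,
      integral_Ioc_eq_integral_Ioo, integral_Ioc_eq_integral_Ioo]
    refine integral_congr_ae ?_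
    have h1 : ∀ᵐ s ∂(volume.restrict (Ioo 0 t)), Z s = ι (D s) :=
      ae_restrict_of_ae_restrict_of_subset (Ioo_subset_Ioo_right ht.2) hDZ
    filter_upwards [h1, ae_restrict_mem measurableSet_Ioo] with s hs hs'
    rw [hWZ s ⟨hs'.1.le, hs'.2.le.trans ht.2⟩, hs]
  have hdm : ∀ t, HasDerivAt (fun t => ∫ s in (0:ℝ)..t, W s) (W t) t := fun t =>
    (hW.integral_hasStrictDerivAt 0 t).hasDerivAt
  have hWd : ∀ s h, ∫ r in s..(s + h), W r = (∫ r in (0:ℝ)..(s + h), W r) - ∫ r in (0:ℝ)..s, W r :=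
    fun s h => (intervalIntegral.integral_interval_sub_left (hW.intervalIntegrable _ _)
      (hW.intervalIntegrable _ _)).symm
  have hgd : ∀ s h, ∫ r in s..(s + h), gh r =
      (∫ r in (0:ℝ)..(s + h), gh r) - ∫ r in (0:ℝ)..s, gh r :=
    fun s h => (intervalIntegral.integral_interval_sub_left hgh.intervalIntegrable
      hgh.intervalIntegrable).symm
  -- The equations at `s + h` and `s` are tested with the increment of the primitive of `D`, whose
  -- image under `ι` is the increment of the primitive of `W`. In the difference the `γ`-term is a
  -- square and can be dropped.
  have hdiff : ∀ h ∈ Ioo 0 (T - t₀), ∀ s ∈ Icc 0 t₀,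
      inner ℝ (∫ r in s..(s + h), W r) (W (s + h) - W s) ≤
        -inner ℝ (∫ r in s..(s + h), gh r) (∫ r in s..(s + h), W r) := by
    intro h hh s hs
    have hs1 : s ∈ Icc 0 T := ⟨hs.1, hs.2.trans ht₀.2.le⟩
    have hs2 : s + h ∈ Icc 0 T := ⟨add_nonneg hs.1 hh.1.le, by linarith [hs.2, hh.2]⟩
    have e1 := heq _ hs1 ((∫ r in (0:ℝ)..(s + h), D r) - ∫ r in (0:ℝ)..s, D r)
    have e2 := heq _ hs2 ((∫ r in (0:ℝ)..(s + h), D r) - ∫ r in (0:ℝ)..s, D r)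
    have e3 : 0 ≤ inner ℝ (γ (∫ r in (0:ℝ)..(s + h), D r) - γ (∫ r in (0:ℝ)..s, D r))
      (γ (∫ r in (0:ℝ)..(s + h), D r) - γ (∫ r in (0:ℝ)..s, D r)) := real_inner_self_nonneg
    rw [map_sub, map_sub, ← hm _ hs1, ← hm _ hs2, ← hWd, ← hWZ _ hs1, ← hgG _ hs1] at e1
    rw [map_sub, map_sub, ← hm _ hs1, ← hm _ hs2, ← hWd, ← hWZ _ hs2, ← hgG _ hs2] at e2
    rw [inner_sub_left] at e3
    rw [real_inner_comm, hgd, inner_sub_left, inner_sub_left]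
    linarith
  have hfin : ∀ h ∈ Ioo 0 (T - t₀),
      (1 / 2) * ‖h⁻¹ • ∫ r in t₀..(t₀ + h), W r‖ ^ 2 - (1 / 2) * ‖h⁻¹ • ∫ r in (0:ℝ)..(0 + h), W r‖ ^ 2
        ≤ -∫ s in Ioc 0 t₀, inner ℝ (h⁻¹ • ∫ r in s..(s + h), gh r)
          (h⁻¹ • ∫ r in s..(s + h), W r) := by
    intro h hh
    have hder : ∀ s, HasDerivAt (fun s => (1 / 2) * ‖h⁻¹ • ∫ r in s..(s + h), W r‖ ^ 2)
        (h⁻¹ ^ 2 * inner ℝ (∫ r in s..(s + h), W r) (W (s + h) - W s)) s := by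
      intro s
      have h1 : HasDerivAt (fun s => h⁻¹ • ∫ r in s..(s + h), W r) (h⁻¹ • (W (s + h) - W s)) s := by
        simp_rw [hWd]
        exact (((hdm (s + h)).comp_add_const s h).sub (hdm s)).const_smul _
      refine (h1.norm_sq.const_mul (1 / 2 : ℝ)).congr_deriv ?_
      rw [real_inner_smul_left, real_inner_smul_right]
      ring
    have hWc : Continuous fun s => ∫ r in s..(s + h), W r := by
      simp_rw [hWd]
      have : Continuous fun t => ∫ s in (0:ℝ)..t, W s :=
        continuous_iff_continuousAt.2 fun t => (hdm t).continuousAt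
      fun_prop
    have hgc : Continuous fun s => ∫ r in s..(s + h), gh r := by
      simp_rw [hgd]
      have : Continuous fun t => ∫ s in (0:ℝ)..t, gh s :=
        intervalIntegral.continuous_primitive (fun a b => hgh.intervalIntegrable) 0
      fun_prop
    have hc1 : Continuous fun s => h⁻¹ ^ 2 * inner ℝ (∫ r in s..(s + h), W r) (W (s + h) - W s) := by
      fun_prop
    rw [← intervalIntegral.integral_eq_sub_of_hasDerivAt (fun s _ => hder s)
      (hc1.intervalIntegrable _ _), ← integral_neg, intervalIntegral.integral_of_le ht₀.1.le]
    refine setIntegral_mono_on (hc1.integrableOn_Icc.mono_set Ioc_subset_Icc_self)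
      ((Continuous.integrableOn_Icc (by fun_prop)).mono_set Ioc_subset_Icc_self) measurableSet_Ioc
      fun s hs => ?_
    rw [real_inner_smul_left, real_inner_smul_right]
    have := mul_le_mul_of_nonneg_left (hdiff h hh s (Ioc_subset_Icc_self hs)) (sq_nonneg h⁻¹)
    linarith
  have hlim : ∀ s, Tendsto (fun h : ℝ => h⁻¹ • ∫ r in s..(s + h), W r) (𝓝[>] 0) (𝓝 (W s)) := by
    intro s
    simp_rw [hWd]
    exact (hdm s).tendsto_slope_zero_right
  have hL := (((hlim t₀).norm.pow 2).const_mul (1 / 2 : ℝ)).sub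
    (((hlim 0).norm.pow 2).const_mul (1 / 2 : ℝ))
  have hR := (tendsto_integral_inner_average hgh hW hM t₀).neg
  have hle := le_of_tendsto_of_tendsto hL hR (by
    filter_upwards [Ioo_mem_nhdsGT (sub_pos.2 ht₀.2)] with h hh using hfin h hh)
  have hnn : 0 ≤ ∫ s in Ioc 0 t₀, inner ℝ (gh s) (W s) := by
    rw [integral_Ioc_eq_integral_Ioo]
    refine integral_nonneg_of_ae ?_
    have h1 : ∀ᵐ s ∂(volume.restrict (Ioo 0 t₀)), 0 ≤ inner ℝ (g s) (Z s) :=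
      ae_restrict_of_ae_restrict_of_subset (Ioo_subset_Ioo_right ht₀.2.le) hpos
    filter_upwards [h1, ae_restrict_mem measurableSet_Ioo] with s hs hs'
    have hs2 : s ∈ Ioo 0 T := ⟨hs'.1, hs'.2.trans ht₀.2⟩
    rw [hWZ s (Ioo_subset_Icc_self hs2)]
    simpa [gh, hs2.1, hs2.2] using hs
  rw [hWZ 0 ⟨le_rfl, hT⟩, hZ0, hWZ t₀ (Ioo_subset_Icc_self ht₀)] at hle
  have : ‖Z t₀‖ ^ 2 ≤ 0 := by
    simp at hle
    linarith
  exact norm_eq_zero.1 (pow_eq_zero_iff (two_ne_zero) |>.1 (le_antisymm this (sq_nonneg _)))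

end Energy

/-! ### Uniqueness of solutions for monotone nonlinearities -/

variable {n : ℕ} {Ω : Set (Euc n)} {T : ℝ}

theorem L2_inner_eq_integral {a b : L2 Ω} {F G : Euc n → ℝ} (ha : a =ᵐ[volume.restrict Ω] F)
    (hb : b =ᵐ[volume.restrict Ω] G) : inner ℝ a b = ∫ x in Ω, F x * G x := by
  rw [L2.inner_def]
  refine integral_congr_ae ?_
  filter_upwards [ha, hb] with x h1 h2
  simp [h1, h2, mul_comm]

/-- The transpose `H → V*`, `w ↦ ⟪w, ι ·⟫`, of a continuous linear map `ι : V → H`. -/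
noncomputable def innerComp {V H : Type*} [NormedAddCommGroup V] [NormedSpace ℝ V]
    [NormedAddCommGroup H] [InnerProductSpace ℝ H] (ι : V →L[ℝ] H) : H →L[ℝ] StrongDual ℝ V where
  toFun w := (innerSL ℝ w).comp ι
  map_add' a b := by
    ext v
    simp
  map_smul' r a := by
    ext v
    simp
  cont := ((innerSL ℝ (E := H)).continuous).clm_comp continuous_const

/-- The gradient on `H¹₀(Ω)`. -/
noncomputable def H10.grad (Ω : Set (Euc n)) : H10 Ω →L[ℝ] PiLp 2 (fun _ : Fin n => L2 Ω) :=
  (WithLp.sndL 2 ℝ (L2 Ω) (PiLp 2 (fun _ : Fin n => L2 Ω))).comp (H10 Ω).subtypeL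

@[simp]
theorem H10.grad_apply (v : H10 Ω) : H10.grad Ω v = (v : Jet1 Ω).snd := rfl

theorem MemL2Time.sub {X : Type*} [NormedAddCommGroup X] {Y Y' : ℝ → X} (h : MemL2Time T Y)
    (h' : MemL2Time T Y') : MemL2Time T (fun t => Y t - Y' t) := MemLp.sub h h'

theorem MemL2Time.clm {X X' : Type*} [NormedAddCommGroup X] [NormedSpace ℝ X]
    [NormedAddCommGroup X'] [NormedSpace ℝ X'] {Y : ℝ → X} (h : MemL2Time T Y) (L : X →L[ℝ] X') :
    MemL2Time T (fun t => L (Y t)) := L.comp_memLp' h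

instance : CompleteSpace (H10 Ω) :=
  (Submodule.isClosed_topologicalClosure _).completeSpace_coe

theorem HasWeakTimeDeriv.sub {X : Type*} [NormedAddCommGroup X] [NormedSpace ℝ X]
    {Y₁ Y₁' Y₂ Y₂' : ℝ → X} (h₁ : HasWeakTimeDeriv T Y₁ Y₁') (h₂ : HasWeakTimeDeriv T Y₂ Y₂')
    (i₁ : MemL2Time T Y₁) (i₁' : MemL2Time T Y₁') (i₂ : MemL2Time T Y₂)
    (i₂' : MemL2Time T Y₂') :
    HasWeakTimeDeriv T (fun t => Y₁ t - Y₂ t) (fun t => Y₁' t - Y₂' t) := by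
  intro ψ hψ
  simp_rw [smul_sub]
  rw [integral_sub (hψ.deriv_isTest.integrableOn_smul (integrableOn_of_memL2Time i₁))
      (hψ.deriv_isTest.integrableOn_smul (integrableOn_of_memL2Time i₂)),
    integral_sub (hψ.integrableOn_smul (integrableOn_of_memL2Time i₁'))
      (hψ.integrableOn_smul (integrableOn_of_memL2Time i₂')), h₁ ψ hψ, h₂ ψ hψ]
  abel

theorem eqOn_Icc_of_ae_eq_Ioo {F G : ℝ → ℝ} (hT : 0 < T) (hF : ContinuousOn F (Icc 0 T))
    (hG : ContinuousOn G (Icc 0 T)) (h : ∀ᵐ t ∂(volume.restrict (Ioo 0 T)), F t = G t) :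
    EqOn F G (Icc 0 T) := by
  refine Measure.eqOn_Icc_of_ae_eq volume hT.ne ?_ hF hG
  rwa [Filter.EventuallyEq, ← Measure.restrict_congr_set Ioo_ae_eq_Icc]

theorem HasWeakTimeDeriv.innerComp_sub {V H : Type*} [NormedAddCommGroup V] [NormedSpace ℝ V]
    [NormedAddCommGroup H] [InnerProductSpace ℝ H] (ι : V →L[ℝ] H) {Y₁ Y₂ : ℝ → V}
    {Y₁' Y₂' : ℝ → StrongDual ℝ V} (h₁ : HasWeakTimeDeriv T (fun t => (innerSL ℝ (ι (Y₁ t))).comp ι) Y₁')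
    (h₂ : HasWeakTimeDeriv T (fun t => (innerSL ℝ (ι (Y₂ t))).comp ι) Y₂')
    (i₁ : MemL2Time T Y₁) (i₁' : MemL2Time T Y₁') (i₂ : MemL2Time T Y₂) (i₂' : MemL2Time T Y₂') :
    HasWeakTimeDeriv T (fun t => innerComp ι (ι (Y₁ t - Y₂ t))) (fun t => Y₁' t - Y₂' t) := by
  simp_rw [map_sub]
  exact HasWeakTimeDeriv.sub h₁ h₂ ((i₁.clm ι).clm (innerComp ι)) i₁'
    ((i₂.clm ι).clm (innerComp ι)) i₂'

/-- Reduces the weak evolution equation to its time-integrated form, which holds at every time and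
not only almost everywhere. -/
theorem eq_zero_of_weak_energy {V H K : Type*} [NormedAddCommGroup V] [NormedSpace ℝ V]
    [CompleteSpace V] [NormedAddCommGroup H] [InnerProductSpace ℝ H] [CompleteSpace H]
    [NormedAddCommGroup K] [InnerProductSpace ℝ K] [CompleteSpace K] (ι : V →L[ℝ] H) (γ : V →L[ℝ] K)
    (hT : 0 < T)
    {D : ℝ → V} {D' : ℝ → StrongDual ℝ V} {Z g : ℝ → H}
    (hDm : MemL2Time T D) (hDm' : MemL2Time T D')
    (hgm : MemL2Time T g) (hZc : ContinuousOn Z (Icc 0 T)) (hZ0 : Z 0 = 0)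
    (hDZ : ∀ᵐ t ∂(volume.restrict (Ioo 0 T)), Z t = ι (D t))
    (hpos : ∀ᵐ t ∂(volume.restrict (Ioo 0 T)), 0 ≤ inner ℝ (g t) (Z t))
    (heqD : ∀ᵐ t ∂(volume.restrict (Ioo 0 T)), ∀ v : V, D' t v =
      -(inner ℝ (γ (D t)) (γ v)) - inner ℝ (g t) (ι v))
    (hwd : HasWeakTimeDeriv T (fun t => innerComp ι (ι (D t))) D') : ∀ t ∈ Ioo 0 T, Z t = 0 := by
  have hD : IntegrableOn D (Ioo 0 T) := integrableOn_of_memL2Time hDm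
  have hD' : IntegrableOn D' (Ioo 0 T) := integrableOn_of_memL2Time hDm'
  have hg : IntegrableOn g (Ioo 0 T) := integrableOn_of_memL2Time hgm
  obtain ⟨c, hc⟩ := hwd.exists_ae_eq_primitive hT
    (integrableOn_of_memL2Time ((hDm.clm ι).clm (innerComp ι))) hD'
  have hii : IntervalIntegrable D' volume 0 T :=
    (intervalIntegrable_iff_integrableOn_Ioo_of_le hT.le).2 hD'
  have hsub : ∀ {t}, t ∈ Icc 0 T → uIcc 0 t ⊆ uIcc 0 T := fun {t} ht => by
    rw [uIcc_of_le ht.1, uIcc_of_le hT.le]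
    exact Icc_subset_Icc_right ht.2
  have hcont : ContinuousOn (fun t => ∫ s in (0:ℝ)..t, D' s) (Icc 0 T) := by
    have := intervalIntegral.continuousOn_primitive_interval' hii left_mem_uIcc
    rwa [uIcc_of_le hT.le] at this
  have hZv : ∀ v : V, ∀ t ∈ Icc 0 T,
      inner ℝ (Z t) (ι v) = (∫ s in (0:ℝ)..t, D' s) v := by
    intro v
    -- Both sides are continuous, so equality extends to the closed interval; at time 0 it shows
    -- that the integration constant vanishes.
    have hE : EqOn (fun t => inner ℝ (Z t) (ι v))
        (fun t => c v + (∫ s in (0:ℝ)..t, D' s) v) (Icc 0 T) := by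
      refine eqOn_Icc_of_ae_eq_Ioo hT (hZc.inner continuousOn_const)
        (continuousOn_const.add (hcont.clm_apply continuousOn_const)) ?_
      filter_upwards [hc, hDZ] with t h1 h2
      rw [h2, ← add_apply, ← h1]
      rfl
    have h0 := hE (left_mem_Icc.2 hT.le)
    simp only [hZ0, inner_zero_left, intervalIntegral.integral_same, zero_apply,
      add_zero] at h0
    intro t ht
    rw [show inner ℝ (Z t) (ι v) = c v + (∫ s in (0:ℝ)..t, D' s) v from hE ht, ← h0,
      zero_add]
  have hDI : IntervalIntegrable D volume 0 T :=
    (intervalIntegrable_iff_integrableOn_Ioo_of_le hT.le).2 hD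
  have hgI : IntervalIntegrable g volume 0 T :=
    (intervalIntegrable_iff_integrableOn_Ioo_of_le hT.le).2 hg
  have hweak : ∀ t ∈ Icc 0 T, ∀ v : V, inner ℝ (Z t) (ι v) +
      inner ℝ (γ (∫ s in (0:ℝ)..t, D s)) (γ v) +
      inner ℝ (∫ s in (0:ℝ)..t, g s) (ι v) = 0 := by
    intro t ht v
    have hDt := hDI.mono_set (hsub ht)
    have hgt := hgI.mono_set (hsub ht)
    have e1 : (∫ s in (0:ℝ)..t, D' s) v = ∫ s in (0:ℝ)..t, D' s v :=
      ContinuousLinearMap.intervalIntegral_apply (hii.mono_set (hsub ht)) v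
    have e2 := ContinuousLinearMap.intervalIntegral_comp_comm
      ((innerSL ℝ (γ v)).comp γ) hDt
    have e3 := ContinuousLinearMap.intervalIntegral_comp_comm (innerSL ℝ (ι v)) hgt
    have j2 : IntervalIntegrable (fun s => ((innerSL ℝ (γ v)).comp γ) (D s))
        volume 0 t := ⟨ContinuousLinearMap.integrable_comp _ hDt.1,
          ContinuousLinearMap.integrable_comp _ hDt.2⟩
    have j3 : IntervalIntegrable (fun s => (innerSL ℝ (ι v)) (g s))
        volume 0 t := ⟨ContinuousLinearMap.integrable_comp _ hgt.1,
          ContinuousLinearMap.integrable_comp _ hgt.2⟩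
    have j4 : IntervalIntegrable (fun s => -(((innerSL ℝ (γ v)).comp γ) (D s))) volume 0 t := j2.neg
    have e4 : ∫ s in (0:ℝ)..t, D' s v = ∫ s in (0:ℝ)..t,
        (-(((innerSL ℝ (γ v)).comp γ) (D s))
          - (innerSL ℝ (ι v)) (g s)) := by
      rw [intervalIntegral.integral_of_le ht.1, intervalIntegral.integral_of_le ht.1,
        integral_Ioc_eq_integral_Ioo, integral_Ioc_eq_integral_Ioo]
      refine integral_congr_ae ?_
      filter_upwards [ae_restrict_of_ae_restrict_of_subset (Ioo_subset_Ioo_right ht.2) heqD]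
        with s hs
      rw [hs v]
      simp only [ContinuousLinearMap.comp_apply, innerSL_apply_apply, real_inner_comm]
    rw [intervalIntegral.integral_sub j4 j3, intervalIntegral.integral_neg, e2, e3] at e4
    rw [hZv v t ht, e1, e4, real_inner_comm (γ v), real_inner_comm (ι v)]
    simp only [ContinuousLinearMap.comp_apply, innerSL_apply_apply]
    ring
  exact fun t ht => eq_zero_of_energy ι γ hD hZc hZ0 hDZ hg hpos hweak ht

theorem IsSolution.ae_eq (hT : 0 < T) {f : ℝ → ℝ} (hf : Monotone f) {u : Euc n × ℝ → ℝ}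
    {y₀ : Euc n → ℝ} {y z : Euc n × ℝ → ℝ} (hy : IsSolution Ω T f u y₀ y)
    (hz : IsSolution Ω T f u y₀ z) : z =ᵐ[volume.restrict (Cyl Ω T)] y := by
  obtain ⟨hfy, Y₁, Y₁', hW₁, heq₁, Z₁, hZ₁c, hZ₁Y, hZ₁0⟩ := hy
  obtain ⟨hfz, Y₂, Y₂', hW₂, heq₂, Z₂, hZ₂c, hZ₂Y, hZ₂0⟩ := hz
  obtain ⟨g₁, hg₁, hg₁r⟩ := exists_represents hfy
  obtain ⟨g₂, hg₂, hg₂r⟩ := exists_represents hfz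
  set D : ℝ → H10 Ω := fun t => Y₂ t - Y₁ t
  set D' : ℝ → HMinusOne Ω := fun t => Y₂' t - Y₁' t
  set Z : ℝ → L2 Ω := fun t => Z₂ t - Z₁ t
  set g : ℝ → L2 Ω := fun t => g₂ t - g₁ t
  have hZc : ContinuousOn Z (Icc 0 T) := hZ₂c.sub hZ₁c
  have hZ0 : Z 0 = 0 := by
    simp only [Z]
    rw [sub_eq_zero]
    exact Lp.ext (hZ₂0.trans hZ₁0.symm)
  have hDZ : ∀ᵐ t ∂(volume.restrict (Ioo 0 T)), Z t = H10.toL2 Ω (D t) := by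
    filter_upwards [hZ₁Y, hZ₂Y] with t h1 h2
    simp only [Z, D, h1, h2, map_sub]
  have hrep : ∀ᵐ t ∂(volume.restrict (Ioo 0 T)),
      Z t =ᵐ[volume.restrict Ω] fun x => z (x, t) - y (x, t) := by
    filter_upwards [hZ₁Y, hZ₂Y, hW₁.represents, hW₂.represents] with t h1 h2 h3 h4
    simp only [Z, h1, h2]
    refine (Lp.coeFn_sub _ _).trans ?_
    filter_upwards [h3, h4] with x h5 h6
    rw [Pi.sub_apply, h5, h6]
  have hpos : ∀ᵐ t ∂(volume.restrict (Ioo 0 T)), 0 ≤ inner ℝ (g t) (Z t) := by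
    filter_upwards [hrep, hg₁r, hg₂r] with t h1 h2 h3
    have h4 : g t =ᵐ[volume.restrict Ω] fun x => f (z (x, t)) - f (y (x, t)) := by
      refine (Lp.coeFn_sub _ _).trans ?_
      filter_upwards [h2, h3] with x h5 h6
      rw [Pi.sub_apply, h5, h6]
    rw [L2_inner_eq_integral h4 h1]
    refine integral_nonneg fun x => ?_
    rcases le_total (z (x, t)) (y (x, t)) with h | h
    · exact mul_nonneg_of_nonpos_of_nonpos (sub_nonpos.2 (hf h)) (sub_nonpos.2 h)
    · exact mul_nonneg (sub_nonneg.2 (hf h)) (sub_nonneg.2 h)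
  have heqD : ∀ᵐ t ∂(volume.restrict (Ioo 0 T)), ∀ v : H10 Ω, D' t v =
      -(inner ℝ (H10.grad Ω (D t)) (H10.grad Ω v)) - inner ℝ (g t) (H10.toL2 Ω v) := by
    filter_upwards [heq₁, heq₂, hg₁r, hg₂r] with t h1 h2 h3 h4 v
    have e1 := h1 v
    have e2 := h2 v
    have e3 := L2_inner_eq_integral h3 (EventuallyEq.refl _ (H10.toL2 Ω v : Euc n → ℝ))
    have e4 := L2_inner_eq_integral h4 (EventuallyEq.refl _ (H10.toL2 Ω v : Euc n → ℝ))
    rw [← e3] at e1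
    rw [← e4] at e2
    simp only [D, D', g, map_sub, inner_sub_left, sub_apply, H10.grad_apply]
    linarith
  have hwd := HasWeakTimeDeriv.innerComp_sub (H10.toL2 Ω) hW₂.deriv hW₁.deriv hW₂.memL2
    hW₂.memL2_deriv hW₁.memL2 hW₁.memL2_deriv
  have hzero := eq_zero_of_weak_energy (H10.toL2 Ω) (H10.grad Ω) hT (hW₂.memL2.sub hW₁.memL2)
    (hW₂.memL2_deriv.sub hW₁.memL2_deriv) (hg₂.sub hg₁) hZc hZ0 hDZ hpos heqD hwd
  have hm₁ := hW₁.memLp.1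
  have hm₂ := hW₂.memLp.1
  rw [restrict_cyl] at hm₁ hm₂ ⊢
  refine ae_eq_prod_of_ae_ae_swap hm₂ hm₁ ?_
  filter_upwards [hrep, ae_restrict_mem measurableSet_Ioo] with t h1 ht
  rw [hzero t ht] at h1
  filter_upwards [h1, Lp.coeFn_zero ℝ 2 (volume.restrict Ω)] with x h2 h3
  rw [h3] at h2
  exact (sub_eq_zero.1 h2.symm)

/-! ### Test functions and weak derivatives in space -/

section Space

variable {n : ℕ} {Ω : Set (Euc n)} {T : ℝ}

theorem IsTest.fderiv_apply {V : Type*} [NormedAddCommGroup V] [NormedSpace ℝ V] {U : Set V}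
    {φ : V → ℝ} (h : IsTest U φ) (e : V) : IsTest U (fun x => fderiv ℝ φ x e) :=
  ⟨(h.1.fderiv_right (m := ∞) (by simp)).clm_apply contDiff_const, h.2.1.fderiv_apply ℝ e,
    (tsupport_fderiv_apply_subset ℝ e).trans h.2.2⟩

theorem IsTest.isTest_pd {φ : Euc n → ℝ} (h : IsTest Ω φ) (i : Fin n) : IsTest Ω (pd i φ) :=
  h.fderiv_apply _

theorem IsTest.integral_mul_pd {φ χ : Euc n → ℝ} (hφ : IsTest Ω φ) (hχ : IsTest Ω χ)
    (i : Fin n) : ∫ x in Ω, φ x * pd i χ x = -∫ x in Ω, pd i φ x * χ x := by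
  have hint : ∀ {a b : Euc n → ℝ}, IsTest Ω a → IsTest Ω b → Integrable (fun x => a x * b x) :=
    fun ha hb => (ha.1.continuous.mul hb.1.continuous).integrable_of_hasCompactSupport
      hb.2.1.mul_left
  rw [setIntegral_eq_integral_of_forall_compl_eq_zero (fun x hx => by rw [hφ.eq_zero hx, zero_mul]),
    setIntegral_eq_integral_of_forall_compl_eq_zero (fun x hx => by rw [hχ.eq_zero hx, mul_zero])]
  exact integral_mul_fderiv_eq_neg_fderiv_mul_of_integrable (hint (hφ.isTest_pd i) hχ) (hint hφ (hχ.isTest_pd i))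
    (hint hφ hχ) (fun x _ => (hφ.1.differentiable (by simp)).differentiableAt)
    (fun x _ => (hχ.1.differentiable (by simp)).differentiableAt)

theorem IsTest.hasWeakPartial {φ : Euc n → ℝ} (hφ : IsTest Ω φ) {i : Fin n} {v w : L2 Ω}
    (hv : v =ᵐ[volume.restrict Ω] φ) (hw : w =ᵐ[volume.restrict Ω] pd i φ) :
    HasWeakPartial Ω i v w := by
  intro χ hχ
  have e1 : ∫ x in Ω, v x * pd i χ x = ∫ x in Ω, φ x * pd i χ x :=
    integral_congr_ae (hv.mul (EventuallyEq.refl _ (pd i χ)))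
  have e2 : ∫ x in Ω, w x * χ x = ∫ x in Ω, pd i φ x * χ x :=
    integral_congr_ae (hw.mul (EventuallyEq.refl _ χ))
  rw [e1, e2]
  exact hφ.integral_mul_pd hχ i

theorem IsTest.mem_H10 {φ : Euc n → ℝ} (hφ : IsTest Ω φ) {V : Jet1 Ω}
    (h0 : V.fst =ᵐ[volume.restrict Ω] φ)
    (h1 : ∀ i, V.snd i =ᵐ[volume.restrict Ω] pd i φ) : V ∈ H10 Ω :=
  Submodule.le_topologicalClosure _ (Submodule.subset_span ⟨φ, hφ, h0, h1⟩)

/-- Integration by parts holds when both functions are test functions, and it is a closed linear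
condition on `V`, hence survives the span and the closure. -/
theorem H10.inner_pd_eq_neg {φ : Euc n → ℝ} (hφ : IsTest Ω φ) (i : Fin n) {a b : L2 Ω}
    (ha : a =ᵐ[volume.restrict Ω] φ) (hb : b =ᵐ[volume.restrict Ω] pd i φ)
    {V : Jet1 Ω} (hV : V ∈ H10 Ω) : inner ℝ a (V.snd i) = -inner ℝ b V.fst := by
  let L : Jet1 Ω →L[ℝ] ℝ :=
    (innerSL ℝ a).comp ((PiLp.proj 2 (fun _ : Fin n => L2 Ω) i).comp
      (WithLp.sndL 2 ℝ (L2 Ω) (PiLp 2 (fun _ : Fin n => L2 Ω)))) +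
    (innerSL ℝ b).comp (WithLp.fstL 2 ℝ (L2 Ω) (PiLp 2 (fun _ : Fin n => L2 Ω)))
  have hle : H10 Ω ≤ L.ker := by
    refine Submodule.topologicalClosure_minimal _ (Submodule.span_le.2 ?_) L.isClosed_ker
    rintro W ⟨χ, hχ, h0, h1⟩
    have e : inner ℝ a (W.snd i) + inner ℝ b W.fst = 0 := by
      rw [L2_inner_eq_integral ha (h1 i), L2_inner_eq_integral hb h0, hφ.integral_mul_pd hχ i]
      exact neg_add_cancel _
    exact e
  have := hle hV
  have e : inner ℝ a (V.snd i) + inner ℝ b V.fst = 0 := this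
  linarith

end Space

/-! ### The time derivative of a function with values in `L²` -/

section Time

variable {n : ℕ} {Ω : Set (Euc n)} {T : ℝ}

theorem memLp_two_mul_prod {α β : Type*} [MeasurableSpace α] [MeasurableSpace β] {μ : Measure α}
    {ν : Measure β} [SFinite μ] [SFinite ν] {a : α → ℝ} {b : β → ℝ} (ha : MemLp a 2 μ)
    (hb : MemLp b 2 ν) : MemLp (fun p : α × β => a p.1 * b p.2) 2 (μ.prod ν) := by
  have hm : AEStronglyMeasurable (fun p : α × β => a p.1 * b p.2) (μ.prod ν) :=
    ha.1.comp_fst.mul hb.1.comp_snd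
  rw [memLp_two_iff_integrable_sq hm]
  simp_rw [mul_pow]
  exact ha.integrable_sq.mul_prod hb.integrable_sq

theorem inner_integral_smul_eq {F : Euc n × ℝ → ℝ} (hF : MemLp F 2 (volume.restrict (Cyl Ω T)))
    {Y : ℝ → L2 Ω} (hY : MemL2Time T Y) (hYF : Represents Ω T Y F) {ψ : ℝ → ℝ}
    (hψ : IsTest (Ioo 0 T) ψ) (w : L2 Ω) :
    inner ℝ w (∫ t in Ioo 0 T, ψ t • Y t) =
      ∫ x in Ω, w x * ∫ t in Ioo 0 T, ψ t * F (x, t) := by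
  rw [restrict_cyl] at hF
  have hψm : MemLp ψ 2 (volume.restrict (Ioo 0 T)) :=
    (hψ.1.continuous.memLp_of_hasCompactSupport hψ.2.1).restrict _
  have hint : Integrable (fun p : Euc n × ℝ => (w p.1 * ψ p.2) * F p)
      ((volume.restrict Ω).prod (volume.restrict (Ioo 0 T))) :=
    (memLp_two_mul_prod (Lp.memLp w) hψm).integrable_mul hF
  have h1 : inner ℝ w (∫ t in Ioo 0 T, ψ t • Y t) = ∫ t in Ioo 0 T, inner ℝ w (ψ t • Y t) :=
    ((innerSL ℝ w).integral_comp_comm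
      (hψ.integrableOn_smul (integrableOn_of_memL2Time hY))).symm
  have h2 : ∫ t in Ioo 0 T, inner ℝ w (ψ t • Y t) =
      ∫ t in Ioo 0 T, ∫ x in Ω, (w x * ψ t) * F (x, t) := by
    refine integral_congr_ae ?_
    filter_upwards [hYF] with t ht
    rw [real_inner_smul_right, L2_inner_eq_integral (EventuallyEq.refl _ (w : Euc n → ℝ)) ht,
      ← integral_const_mul]
    refine integral_congr_ae (ae_of_all _ fun x => ?_)
    ring
  rw [h1, h2, ← integral_integral_swap (f := fun x t => (w x * ψ t) * F (x, t)) hint]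
  refine integral_congr_ae (ae_of_all _ fun x => ?_)
  simp_rw [mul_assoc]
  exact integral_const_mul _ _

/-- Pairing with an arbitrary `w` and applying Fubini turns the Bochner identity into scalar
integration by parts in time for almost every fixed `x`. -/
theorem hasWeakTimeDeriv_of_ae_isTest {F G : Euc n × ℝ → ℝ}
    (hF : MemLp F 2 (volume.restrict (Cyl Ω T))) (hG : MemLp G 2 (volume.restrict (Cyl Ω T)))
    {Y Y' : ℝ → L2 Ω} (hY : MemL2Time T Y) (hYF : Represents Ω T Y F) (hY' : MemL2Time T Y')
    (hYG : Represents Ω T Y' G)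
    (h : ∀ᵐ x ∂(volume.restrict Ω), IsTest (Ioo 0 T) (fun t => F (x, t)) ∧
      deriv (fun t => F (x, t)) = fun t => G (x, t)) : HasWeakTimeDeriv T Y Y' := by
  intro ψ hψ
  refine ext_inner_left ℝ fun w => ?_
  rw [inner_neg_right, inner_integral_smul_eq hF hY hYF hψ.deriv_isTest,
    inner_integral_smul_eq hG hY' hYG hψ, ← integral_neg]
  refine integral_congr_ae ?_
  filter_upwards [h] with x ⟨h1, h2⟩
  have hint : ∀ {a b : ℝ → ℝ}, IsTest (Ioo 0 T) a → IsTest (Ioo 0 T) b →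
      Integrable (fun x => a x * b x) :=
    fun ha hb => (ha.1.continuous.mul hb.1.continuous).integrable_of_hasCompactSupport
      hb.2.1.mul_left
  have h3 := integral_mul_fderiv_eq_neg_fderiv_mul_of_integrable (μ := (volume : Measure ℝ))
    (v := (1 : ℝ)) (f := ψ) (g := fun t => F (x, t)) (hint (hψ.fderiv_apply 1) h1)
    (hint hψ (h1.fderiv_apply 1)) (hint hψ h1)
    (fun x _ => (hψ.1.differentiable (by simp)).differentiableAt)
    (fun x _ => (h1.1.differentiable (by simp)).differentiableAt)
  simp only [fderiv_apply_one_eq_deriv, h2] at h3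
  rw [setIntegral_eq_integral_of_forall_compl_eq_zero (fun t ht => by rw [h1.eq_zero ht, mul_zero]),
    setIntegral_eq_integral_of_forall_compl_eq_zero (fun t ht => by
      rw [hψ.eq_zero ht, zero_mul]), h3]
  ring

theorem HasWeakTimeDeriv.clm {X X' : Type*} [NormedAddCommGroup X] [NormedSpace ℝ X]
    [CompleteSpace X] [NormedAddCommGroup X'] [NormedSpace ℝ X'] [CompleteSpace X'] {Y Y' : ℝ → X}
    (h : HasWeakTimeDeriv T Y Y') (hY : MemL2Time T Y) (hY' : MemL2Time T Y') (L : X →L[ℝ] X') :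
    HasWeakTimeDeriv T (fun t => L (Y t)) (fun t => L (Y' t)) := by
  intro ψ hψ
  simp_rw [← map_smul]
  rw [L.integral_comp_comm (hψ.deriv_isTest.integrableOn_smul (integrableOn_of_memL2Time hY)),
    L.integral_comp_comm (hψ.integrableOn_smul (integrableOn_of_memL2Time hY')), h ψ hψ, map_neg]

theorem HasWeakTimeDeriv.congr {X : Type*} [NormedAddCommGroup X] [NormedSpace ℝ X]
    {Y₁ Y₂ Y' : ℝ → X} (h : HasWeakTimeDeriv T Y₁ Y')
    (hY : ∀ᵐ t ∂(volume.restrict (Ioo 0 T)), Y₁ t = Y₂ t) : HasWeakTimeDeriv T Y₂ Y' := by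
  intro ψ hψ
  rw [← h ψ hψ]
  refine integral_congr_ae ?_
  filter_upwards [hY] with t ht
  rw [ht]

end Time

/-! ### Functions which are smooth away from one point of the cylinder -/

section Singular

variable {n : ℕ} {Ω : Set (Euc n)} {T : ℝ}

/-- The derivative of `y` in the space-time direction `e`. -/
noncomputable def dirDeriv (e : Euc n × ℝ) (y : Euc n × ℝ → ℝ) (p : Euc n × ℝ) : ℝ :=
  fderiv ℝ y p e

/-- The `i`-th spatial direction in space-time. -/
noncomputable def spaceDir (i : Fin n) : Euc n × ℝ := (EuclideanSpace.single i 1, 0)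

/-- The time direction in space-time. -/
def timeDir : Euc n × ℝ := (0, 1)

/-- `y` is smooth off the point `p₀` and vanishes off the compact set `K × J`. -/
structure IsSmoothOff (p₀ : Euc n × ℝ) (K : Set (Euc n)) (J : Set ℝ) (y : Euc n × ℝ → ℝ) :
    Prop where
  compact_space : IsCompact K
  compact_time : IsCompact J
  smooth : ∀ p, p ≠ p₀ → ContDiffAt ℝ ∞ y p
  zero : ∀ p, p ∉ K ×ˢ J → y p = 0

variable {p₀ : Euc n × ℝ} {K : Set (Euc n)} {J : Set ℝ} {y : Euc n × ℝ → ℝ}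

theorem IsSmoothOff.dirDeriv (h : IsSmoothOff p₀ K J y) (e : Euc n × ℝ) :
    IsSmoothOff p₀ K J (dirDeriv e y) where
  compact_space := h.compact_space
  compact_time := h.compact_time
  smooth p hp := ((h.smooth p hp).fderiv_right (m := ∞) (by simp)).clm_apply contDiffAt_const
  zero p hp := by
    have h1 : y =ᶠ[𝓝 p] fun _ => 0 := by
      filter_upwards [(h.compact_space.prod h.compact_time).isClosed.isOpen_compl.mem_nhds hp]
        with q hq using h.zero q hq
    simp [ParabolicExample.dirDeriv, h1.fderiv_eq]

theorem IsSmoothOff.isTest_space (h : IsSmoothOff p₀ K J y) (hK : K ⊆ Ω) {t : ℝ}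
    (ht : t ≠ p₀.2) : IsTest Ω (fun x => y (x, t)) := by
  have hts : tsupport (fun x => y (x, t)) ⊆ K := by
    refine closure_minimal (fun x hx => ?_) h.compact_space.isClosed
    by_contra hxK
    exact hx (h.zero _ fun h' => hxK h'.1)
  refine ⟨contDiff_iff_contDiffAt.2 fun x => ?_, ?_, hts.trans hK⟩
  · exact (h.smooth (x, t) (fun h' => ht (by rw [← h']))).comp x
      (contDiffAt_id.prodMk contDiffAt_const)
  · exact HasCompactSupport.of_support_subset_isCompact h.compact_space (subset_closure.trans hts)

theorem IsSmoothOff.isTest_time (h : IsSmoothOff p₀ K J y) (hJ : J ⊆ Ioo 0 T) {x : Euc n}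
    (hx : x ≠ p₀.1) : IsTest (Ioo 0 T) (fun t => y (x, t)) := by
  have hts : tsupport (fun t => y (x, t)) ⊆ J := by
    refine closure_minimal (fun t ht => ?_) h.compact_time.isClosed
    by_contra htJ
    exact ht (h.zero _ fun h' => htJ h'.2)
  refine ⟨contDiff_iff_contDiffAt.2 fun t => ?_, ?_, hts.trans hJ⟩
  · exact (h.smooth (x, t) (fun h' => hx (by rw [← h']))).comp t
      (contDiffAt_const.prodMk contDiffAt_id)
  · exact HasCompactSupport.of_support_subset_isCompact h.compact_time (subset_closure.trans hts)

theorem IsSmoothOff.pd_slice (h : IsSmoothOff p₀ K J y) {t : ℝ} (ht : t ≠ p₀.2) (i : Fin n) :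
    pd i (fun x => y (x, t)) = fun x => ParabolicExample.dirDeriv (spaceDir i) y (x, t) := by
  funext x
  have h1 : HasFDerivAt y (fderiv ℝ y (x, t)) (x, t) :=
    ((h.smooth (x, t) (fun h' => ht (by rw [← h']))).differentiableAt (by simp)).hasFDerivAt
  have h2 := h1.comp x (hasFDerivAt_prodMk_left (𝕜 := ℝ) x t)
  rw [pd, show (fun x => y (x, t)) = y ∘ fun x => (x, t) from rfl, h2.fderiv]
  rfl

theorem IsSmoothOff.deriv_slice (h : IsSmoothOff p₀ K J y) {p : Euc n × ℝ} (hp : p ≠ p₀) :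
    deriv (fun t => y (p.1, t)) p.2 = ParabolicExample.dirDeriv timeDir y p := by
  have h1 : HasFDerivAt y (fderiv ℝ y (p.1, p.2)) (p.1, p.2) :=
    ((h.smooth p hp).differentiableAt (by simp)).hasFDerivAt
  have h2 := h1.comp p.2 (hasFDerivAt_prodMk_right (𝕜 := ℝ) p.1 p.2)
  rw [← fderiv_apply_one_eq_deriv, show (fun t => y (p.1, t)) = y ∘ fun t => (p.1, t) from rfl,
    h2.fderiv]
  rfl

theorem IsSmoothOff.laplacian_slice (h : IsSmoothOff p₀ K J y) {t : ℝ} (ht : t ≠ p₀.2)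
    (x : Euc n) : Laplacian.laplacian (fun x => y (x, t)) x = ∑ i,
      ParabolicExample.dirDeriv (spaceDir i) (ParabolicExample.dirDeriv (spaceDir i) y) (x, t) := by
  rw [InnerProductSpace.laplacian_eq_iteratedFDeriv_orthonormalBasis _
    (EuclideanSpace.basisFun (Fin n) ℝ)]
  refine Finset.sum_congr rfl fun i _ => ?_
  rw [iteratedFDeriv_two_apply]
  have hsm := (h.isTest_space (Ω := univ) (subset_univ _) ht).1
  have hd : DifferentiableAt ℝ (fderiv ℝ fun x => y (x, t)) x :=
    ((hsm.fderiv_right (m := 1) (by norm_cast)).differentiable (by simp)).differentiableAt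
  have h1 := congrFun ((h.dirDeriv (spaceDir i)).pd_slice ht i) x
  rw [← h1, ← h.pd_slice ht i, pd]
  have h2 : pd i (fun x => y (x, t)) =
      fun x => fderiv ℝ (fun x => y (x, t)) x (EuclideanSpace.single i 1) := rfl
  rw [h2, fderiv_clm_apply hd (differentiableAt_const _)]
  simp

/-- A function which is smooth off `p₀`, supported in `K × J`, and square integrable together with
`∂ᵢy`, `∂ₜy` and `∂ᵢ∂ⱼy`. -/
structure IsRegularOff (p₀ : Euc n × ℝ) (K : Set (Euc n)) (J : Set ℝ) (y : Euc n × ℝ → ℝ) :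
    Prop extends IsSmoothOff p₀ K J y where
  memLp_zero : MemLp y 2 volume
  memLp_space : ∀ i, MemLp (ParabolicExample.dirDeriv (spaceDir i) y) 2 volume
  memLp_time : MemLp (ParabolicExample.dirDeriv timeDir y) 2 volume
  memLp_space_space : ∀ i j, MemLp (ParabolicExample.dirDeriv (spaceDir i)
    (ParabolicExample.dirDeriv (spaceDir j) y)) 2 volume

theorem ae_restrict_ne {α : Type*} [MeasurableSpace α] {μ : Measure α} [NullSingletonClass μ] (a : α)
    (s : Set α) : ∀ᵐ x ∂(μ.restrict s), x ≠ a :=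
  ae_restrict_of_ae (by simp [ae_iff])

theorem IsRegularOff.exists_jet (h : IsRegularOff p₀ K J y) (hK : K ⊆ Ω) :
    ∃ Y : ℝ → Jet2 Ω, MemL2Time T Y ∧
      (∀ᵐ t ∂(volume.restrict (Ioo 0 T)), IsH2 Ω (Y t) ∧ (Y t).fst ∈ H10 Ω) ∧
      Represents Ω T (fun t => (Y t).fst.fst) y ∧
      (∀ i, Represents Ω T (fun t => (Y t).fst.snd i) (dirDeriv (spaceDir i) y)) := by
  obtain ⟨Y0, hY0, hY0r⟩ := exists_represents (Ω := Ω) (T := T) (h.memLp_zero.restrict _)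
  choose Y1 hY1 hY1r using fun i : Fin n =>
    exists_represents (Ω := Ω) (T := T) ((h.memLp_space i).restrict _)
  choose Y2 hY2 hY2r using fun ij : Fin n × Fin n => exists_represents (Ω := Ω) (T := T)
    ((h.memLp_space_space ij.2 ij.1).restrict _)
  let Y : ℝ → Jet2 Ω := fun t => WithLp.toLp 2
    (WithLp.toLp 2 (Y0 t, WithLp.toLp 2 fun i => Y1 i t), WithLp.toLp 2 fun ij => Y2 ij t)
  refine ⟨Y, ?_, ?_, hY0r, hY1r⟩
  · refine memLp_prodLp_iff.2 ⟨memLp_prodLp_iff.2 ⟨hY0, memLp_piLp_iff.2 hY1⟩, memLp_piLp_iff.2 hY2⟩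
  · filter_upwards [hY0r, ae_all_iff.2 hY1r, ae_all_iff.2 hY2r, ae_restrict_ne p₀.2 (Ioo 0 T)]
      with t h0 h1 h2 ht
    have hs := h.isTest_space hK ht
    have h1' : ∀ i, Y1 i t =ᵐ[volume.restrict Ω] pd i fun x => y (x, t) := by
      intro i
      rw [h.pd_slice ht i]
      exact h1 i
    refine ⟨⟨fun i => hs.hasWeakPartial h0 (h1' i), fun i j => ?_⟩, hs.mem_H10 h0 h1'⟩
    have hd := h.toIsSmoothOff.dirDeriv (spaceDir i)
    refine (hd.isTest_space hK ht).hasWeakPartial (h1 i) ?_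
    rw [hd.pd_slice ht j]
    exact h2 (i, j)

theorem IsRegularOff.exists_timeDeriv (h : IsRegularOff p₀ K J y) (hn : 0 < n)
    (hJ : J ⊆ Ioo 0 T) :
    ∃ Y Y' : ℝ → L2 Ω, MemL2Time T Y ∧ MemL2Time T Y' ∧ HasWeakTimeDeriv T Y Y' ∧
      Represents Ω T Y y ∧ Represents Ω T Y' (dirDeriv timeDir y) := by
  -- Positive dimension makes the singular point of space a null set.
  have : Nonempty (Fin n) := ⟨⟨0, hn⟩⟩
  have hm : MemLp y 2 (volume.restrict (Cyl Ω T)) := h.memLp_zero.restrict _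
  have hm' : MemLp (dirDeriv timeDir y) 2 (volume.restrict (Cyl Ω T)) :=
    (h.memLp_time).restrict _
  obtain ⟨Y, hY, hYr⟩ := exists_represents hm
  obtain ⟨Y', hY', hYr'⟩ := exists_represents hm'
  refine ⟨Y, Y', hY, hY', hasWeakTimeDeriv_of_ae_isTest hm hm' hY hYr hY' hYr' ?_, hYr, hYr'⟩
  filter_upwards [ae_restrict_ne p₀.1 Ω] with x hx
  refine ⟨h.isTest_time hJ hx, funext fun t => ?_⟩
  exact h.deriv_slice (p := (x, t)) (fun h' => hx (by rw [← h']))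

theorem IsRegularOff.mem_strongSpace (h : IsRegularOff p₀ K J y) (hn : 0 < n) (hK : K ⊆ Ω)
    (hJ : J ⊆ Ioo 0 T) : y ∈ strongSpace Ω T := by
  refine ⟨h.memLp_zero.restrict _, ?_, ?_⟩
  · obtain ⟨Y, h1, h2, h3, -⟩ := h.exists_jet (T := T) hK
    exact ⟨Y, h1, h2, h3⟩
  · obtain ⟨Y, Y', h1, h2, h3, h4, -⟩ := h.exists_timeDeriv (Ω := Ω) hn hJ
    exact ⟨Y, Y', h1, h2, h3, h4⟩

theorem IsRegularOff.heat_eq (h : IsRegularOff p₀ K J y) {p : Euc n × ℝ} (hp : p.2 ≠ p₀.2) :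
    heat y p = dirDeriv timeDir y p - ∑ i, dirDeriv (spaceDir i) (dirDeriv (spaceDir i) y) p := by
  rw [heat, h.deriv_slice (fun h' => hp (by rw [h'])), h.laplacian_slice hp]

theorem ae_snd_ne (a : ℝ) : ∀ᵐ p : Euc n × ℝ, p.2 ≠ a := by
  have := (Measure.quasiMeasurePreserving_snd (μ := (volume : Measure (Euc n)))
    (ν := (volume : Measure ℝ))).ae (p := fun t => t ≠ a) (by simp [ae_iff])
  exact this

theorem IsRegularOff.memLp_heat (h : IsRegularOff p₀ K J y) : MemLp (heat y) 2 volume := by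
  have h1 : MemLp (fun p => dirDeriv timeDir y p -
      ∑ i, dirDeriv (spaceDir i) (dirDeriv (spaceDir i) y) p) 2 volume :=
    (h.memLp_time).sub (memLp_finsetSum _ fun i _ => h.memLp_space_space i i)
  refine h1.ae_eq ?_
  filter_upwards [ae_snd_ne p₀.2] with p hp
  rw [h.heat_eq hp]

/-! ### From regular functions with one singular point to weak solutions -/

theorem eqOn_zero_of_ae_eq {E : Type*} [NormedAddCommGroup E] {a : ℝ} (ha : 0 < a) {F : ℝ → E}
    (hF : ContinuousOn F (Icc 0 a)) (h : ∀ᵐ t ∂(volume.restrict (Ioo 0 a)), F t = 0) : F 0 = 0 := by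
  refine Measure.eqOn_Icc_of_ae_eq (g := fun _ => (0 : E)) volume ha.ne ?_ hF continuousOn_const
    (left_mem_Icc.2 ha.le)
  rwa [Filter.EventuallyEq, ← Measure.restrict_congr_set Ioo_ae_eq_Icc]

theorem HasWeakTimeDeriv.exists_continuous {E : Type*} [NormedAddCommGroup E] [NormedSpace ℝ E]
    [CompleteSpace E] (hT : 0 < T) {Y Y' : ℝ → E} (h : HasWeakTimeDeriv T Y Y')
    (hY : MemL2Time T Y) (hY' : MemL2Time T Y') {a : ℝ} (ha : 0 < a) (haT : a ≤ T)
    (h0 : ∀ᵐ t ∂(volume.restrict (Ioo 0 a)), Y t = 0) :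
    ∃ Z : ℝ → E, ContinuousOn Z (Icc 0 T) ∧
      (∀ᵐ t ∂(volume.restrict (Ioo 0 T)), Z t = Y t) ∧ Z 0 = 0 := by
  obtain ⟨c, hc⟩ := h.exists_ae_eq_primitive hT (integrableOn_of_memL2Time hY)
    (integrableOn_of_memL2Time hY')
  have hii : IntervalIntegrable Y' volume 0 T :=
    (intervalIntegrable_iff_integrableOn_Ioo_of_le hT.le).2 (integrableOn_of_memL2Time hY')
  have hcont : ContinuousOn (fun t => c + ∫ s in (0:ℝ)..t, Y' s) (Icc 0 T) := by
    have := intervalIntegral.continuousOn_primitive_interval' hii left_mem_uIcc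
    rw [uIcc_of_le hT.le] at this
    exact continuousOn_const.add this
  refine ⟨_, hcont, ?_, ?_⟩
  · filter_upwards [hc] with t ht using ht.symm
  · refine eqOn_zero_of_ae_eq ha (hcont.mono (Icc_subset_Icc_right haT)) ?_
    filter_upwards [ae_restrict_of_ae_restrict_of_subset (Ioo_subset_Ioo_right haT) hc, h0]
      with t h1 h2
    rw [← h1, h2]

theorem MemL2Time.innerComp {V H : Type*} [NormedAddCommGroup V] [NormedSpace ℝ V]
    [NormedAddCommGroup H] [InnerProductSpace ℝ H] (ι : V →L[ℝ] H) {Y : ℝ → H}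
    (h : MemL2Time T Y) : MemL2Time T (fun t => innerComp ι (Y t)) := h.clm _

theorem HasWeakTimeDeriv.innerComp {V H : Type*} [NormedAddCommGroup V] [NormedSpace ℝ V]
    [NormedAddCommGroup H] [InnerProductSpace ℝ H] [CompleteSpace H] (ι : V →L[ℝ] H)
    {Y Y' : ℝ → H} (h : HasWeakTimeDeriv T Y Y') (hY : MemL2Time T Y) (hY' : MemL2Time T Y')
    {P : ℝ → V} (hP : ∀ᵐ t ∂(volume.restrict (Ioo 0 T)), Y t = ι (P t)) :
    HasWeakTimeDeriv T (fun t => (innerSL ℝ (ι (P t))).comp ι)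
      (fun t => innerComp ι (Y' t)) := by
  refine (h.clm hY hY' (ParabolicExample.innerComp ι)).congr ?_
  filter_upwards [hP] with t ht
  rw [ht]
  rfl

/-- The jet lies in `H10` only for almost every time. Orthogonal projection, continuous and equal to
the identity on `H10`, gives values in the subspace at all times and keeps measurability. -/
theorem IsRegularOff.exists_H10 (h : IsRegularOff p₀ K J y) (hK : K ⊆ Ω) :
    ∃ P : ℝ → H10 Ω, MemL2Time T P ∧ Represents Ω T (fun t => H10.toL2 Ω (P t)) y ∧
      ∀ i, Represents Ω T (fun t => (P t : Jet1 Ω).snd i) (dirDeriv (spaceDir i) y) := by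
  obtain ⟨V, hV, hVH, hV0, hV1⟩ := h.exists_jet (T := T) hK
  have hV' : MemL2Time T fun t => (V t).fst := hV.prodLp_fst
  have hP : ∀ᵐ t ∂(volume.restrict (Ioo 0 T)),
      (((H10 Ω).orthogonalProjectionOnto (V t).fst : H10 Ω) : Jet1 Ω) = (V t).fst := by
    filter_upwards [hVH] with t ht
    exact congrArg Subtype.val
      (Submodule.orthogonalProjectionOnto_mem_subspace_eq_self (K := H10 Ω) ⟨(V t).fst, ht.2⟩)
  refine ⟨fun t => (H10 Ω).orthogonalProjectionOnto (V t).fst,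
    hV'.clm (H10 Ω).orthogonalProjectionOnto, ?_, fun i => ?_⟩
  · filter_upwards [hP, hV0] with t h1 h2
    have : H10.toL2 Ω ((H10 Ω).orthogonalProjectionOnto (V t).fst) =
        (((H10 Ω).orthogonalProjectionOnto (V t).fst : H10 Ω) : Jet1 Ω).fst := rfl
    rw [this, h1]
    exact h2
  · filter_upwards [hP, hV1 i] with t h1 h2
    rw [h1]
    exact h2

theorem IsRegularOff.inner_grad_eq (h : IsRegularOff p₀ K J y) (hK : K ⊆ Ω) {t : ℝ}
    (ht : t ≠ p₀.2) {w : Fin n → L2 Ω} {G : PiLp 2 (fun _ : Fin n => L2 Ω)}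
    (hG : ∀ i, G i =ᵐ[volume.restrict Ω] fun x => dirDeriv (spaceDir i) y (x, t))
    (hw : ∀ i, w i =ᵐ[volume.restrict Ω] fun x =>
      dirDeriv (spaceDir i) (dirDeriv (spaceDir i) y) (x, t)) (v : H10 Ω) :
    inner ℝ G (v : Jet1 Ω).snd = -inner ℝ (∑ i, w i) (H10.toL2 Ω v) := by
  rw [PiLp.inner_apply, sum_inner, ← Finset.sum_neg_distrib]
  refine Finset.sum_congr rfl fun i _ => ?_
  have hd := h.toIsSmoothOff.dirDeriv (spaceDir i)
  refine H10.inner_pd_eq_neg (hd.isTest_space hK ht) i (hG i) ?_ v.2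
  rw [hd.pd_slice ht i]
  exact hw i

theorem IsRegularOff.isSolution (h : IsRegularOff p₀ K J y) (hn : 0 < n) (hT : 0 < T) (hK : K ⊆ Ω)
    (hJ : J ⊆ Ioo 0 T) {f : ℝ → ℝ} (hf : MemLp (fun p => f (y p)) 2 (volume.restrict (Cyl Ω T)))
    {u : Euc n × ℝ → ℝ} (hu : ∀ p, u p = heat y p + f (y p)) : IsSolution Ω T f u 0 y := by
  obtain ⟨P, hPm, hP0, hP1⟩ := h.exists_H10 (T := T) hK
  obtain ⟨Y, Y', hY, hY', hYd, hYr, hYr'⟩ := h.exists_timeDeriv (Ω := Ω) hn hJ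
  choose W hW hWr using fun i : Fin n => exists_represents (Ω := Ω) (T := T)
    ((h.memLp_space_space i i).restrict _)
  obtain ⟨g, hg, hgr⟩ := exists_represents hf
  have hPY : ∀ᵐ t ∂(volume.restrict (Ioo 0 T)), Y t = H10.toL2 Ω (P t) := by
    filter_upwards [hP0, hYr] with t h1 h2
    exact Lp.ext (h2.trans h1.symm)
  -- The support in time stays away from 0, so the continuous representative has initial value zero.
  obtain ⟨a, b, ha, hb, hab, hJab⟩ := exists_Icc_of_isCompact_subset_Ioo hT h.compact_time hJ
  have haT : a ≤ T := hab.trans hb.le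
  have hY0 : ∀ᵐ t ∂(volume.restrict (Ioo 0 a)), Y t = 0 := by
    filter_upwards [ae_restrict_of_ae_restrict_of_subset (Ioo_subset_Ioo_right haT) hYr,
      ae_restrict_mem measurableSet_Ioo] with t h2 h3
    refine Lp.ext (h2.trans ?_)
    filter_upwards [Lp.coeFn_zero ℝ 2 (volume.restrict Ω)] with x hx
    rw [hx]
    exact h.zero _ fun h' => absurd (hJab h'.2).1 (not_le.2 h3.2)
  obtain ⟨Z, hZc, hZY, hZ0⟩ := hYd.exists_continuous hT hY hY' ha haT hY0
  have heq : ∀ᵐ t ∂(volume.restrict (Ioo 0 T)), ∀ v : H10 Ω,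
      inner ℝ (Y' t) (H10.toL2 Ω v) + inner ℝ (P t : Jet1 Ω).snd (v : Jet1 Ω).snd
        + ∫ x in Ω, f (y (x, t)) * H10.toL2 Ω v x = ∫ x in Ω, u (x, t) * H10.toL2 Ω v x := by
    filter_upwards [ae_all_iff.2 hP1, hYr', ae_all_iff.2 hWr, hgr, ae_restrict_ne p₀.2 (Ioo 0 T)]
      with t h2 h3 h4 h5 ht v
    have e1 : ∫ x in Ω, f (y (x, t)) * H10.toL2 Ω v x = inner ℝ (g t) (H10.toL2 Ω v) :=
      (L2_inner_eq_integral h5 (EventuallyEq.refl _ (H10.toL2 Ω v : Euc n → ℝ))).symm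
    have e2 : (Y' t - ∑ i, W i t + g t : L2 Ω) =ᵐ[volume.restrict Ω] fun x => u (x, t) := by
      have e3 : ((∑ i, W i t : L2 Ω) : Euc n → ℝ) =ᵐ[volume.restrict Ω] fun x =>
          ∑ i, dirDeriv (spaceDir i) (dirDeriv (spaceDir i) y) (x, t) := by
        refine (Lp.coeFn_fun_finsetSum _ _).trans ?_
        filter_upwards [ae_all_iff.2 h4] with x hx
        exact Finset.sum_congr rfl fun i _ => hx i
      filter_upwards [Lp.coeFn_add (Y' t - ∑ i, W i t) (g t), Lp.coeFn_sub (Y' t) (∑ i, W i t), e3, h3,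
        h5] with x k1 k2 k3 k4 k5
      rw [k1, Pi.add_apply, k2, Pi.sub_apply, k3, k4, k5, hu, h.heat_eq (p := (x, t)) ht]
    have e3 : ∫ x in Ω, u (x, t) * H10.toL2 Ω v x =
        inner ℝ (Y' t - ∑ i, W i t + g t) (H10.toL2 Ω v) :=
      (L2_inner_eq_integral e2 (EventuallyEq.refl _ (H10.toL2 Ω v : Euc n → ℝ))).symm
    rw [e1, e3, h.inner_grad_eq hK ht h2 h4 v, inner_add_left, inner_sub_left]
    ring
  refine ⟨hf, P, fun t => innerComp (H10.toL2 Ω) (Y' t), ⟨h.memLp_zero.restrict _, hPm,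
    hY'.innerComp _, hYd.innerComp (H10.toL2 Ω) hY hY' hPY, hP0⟩, heq, Z, hZc, ?_, ?_⟩
  · filter_upwards [hZY, hPY] with t h1 h2
    rw [h1, h2]
  · rw [hZ0]
    exact Lp.coeFn_zero _ _ _

end Singular

/-! ### Series of rescaled cut-off functions -/

section Series

variable {n : ℕ}

/-- The parabolic rescaling of `φ` about `p₀` by the factor `s`. -/
def rescale (φ : Euc n × ℝ → ℝ) (p₀ : Euc n × ℝ) (s : ℝ) (p : Euc n × ℝ) : ℝ :=
  φ (s • (p.1 - p₀.1), s ^ 2 * (p.2 - p₀.2))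

/-- The parabolic box with centre `p₀` and size `2 / s`. -/
def box (p₀ : Euc n × ℝ) (s : ℝ) : Set (Euc n × ℝ) :=
  Metric.closedBall p₀.1 (2 / s) ×ˢ Metric.closedBall p₀.2 (2 / s ^ 2)

/-- The dyadic scales. -/
def scale (r : ℝ) (k : ℕ) : ℝ := r * 2 ^ (k + 1)

/-- `∑ₖ (k+1)⁻¹ φ(sₖ(x-x₀), sₖ²(t-t₀))` with the dyadic scales `sₖ = r 2ᵏ⁺¹`. -/
noncomputable def series (φ : Euc n × ℝ → ℝ) (p₀ : Euc n × ℝ) (r : ℝ) (p : Euc n × ℝ) : ℝ :=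
  ∑' k : ℕ, ((k : ℝ) + 1)⁻¹ * rescale φ p₀ (scale r k) p

variable {φ : Euc n × ℝ → ℝ} {p₀ : Euc n × ℝ} {r s : ℝ}

/-! ### Rescaling and the nested boxes -/

theorem mem_box {p : Euc n × ℝ} :
    p ∈ box p₀ s ↔ ‖p.1 - p₀.1‖ ≤ 2 / s ∧ |p.2 - p₀.2| ≤ 2 / s ^ 2 := by
  rw [box, mem_prod, mem_closedBall_iff_norm, mem_closedBall_iff_norm, Real.norm_eq_abs]

theorem isCompact_box : IsCompact (box p₀ s) :=
  (isCompact_closedBall _ _).prod (isCompact_closedBall _ _)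

theorem box_anti {s' : ℝ} (hs : 0 < s) (h : s ≤ s') : box p₀ s' ⊆ box p₀ s := by
  refine prod_mono (Metric.closedBall_subset_closedBall ?_) (Metric.closedBall_subset_closedBall ?_)
  · gcongr
  · gcongr

theorem rescale_eq_zero (hs : 0 < s)
    (hφ : ∀ p ∉ Metric.closedBall (0 : Euc n) 2 ×ˢ Icc (-2 : ℝ) 2, φ p = 0)
    {p : Euc n × ℝ} (hp : p ∉ box p₀ s) : rescale φ p₀ s p = 0 := by
  refine hφ _ fun h => hp (mem_box.2 ⟨?_, ?_⟩)
  · have h1 := mem_closedBall_zero_iff.1 h.1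
    rw [norm_smul, Real.norm_of_nonneg hs.le] at h1
    rwa [le_div_iff₀ hs, mul_comm]
  · have h1 : |s ^ 2 * (p.2 - p₀.2)| ≤ 2 := abs_le.2 h.2
    rw [abs_mul, abs_of_pos (by positivity)] at h1
    rwa [le_div_iff₀ (by positivity), mul_comm]

theorem rescale_eq_one (hφ : IsCutoff φ) (hs : 0 < s) {p : Euc n × ℝ} (h1 : ‖p.1 - p₀.1‖ < 1 / s)
    (h2 : |p.2 - p₀.2| < 1 / s ^ 2) : rescale φ p₀ s p = 1 := by
  refine hφ.eq_one _ ⟨?_, abs_le.1 ?_⟩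
  · rw [mem_ball_zero_iff, norm_smul, Real.norm_of_nonneg hs.le]
    rwa [lt_div_iff₀ hs, mul_comm] at h1
  · rw [abs_mul, abs_of_pos (by positivity)]
    rw [lt_div_iff₀ (by positivity), mul_comm] at h2
    exact h2.le

/-- The vanishing set is cut down to the complement of a closed box: on an open set derivatives
vanish as well, so the same condition passes to all `dirDeriv`. -/
theorem IsCutoff.eq_zero_closedBall (hφ : IsCutoff φ) :
    ∀ p ∉ Metric.closedBall (0 : Euc n) 2 ×ˢ Icc (-2 : ℝ) 2, φ p = 0 := fun p hp =>
  hφ.eq_zero p fun h => hp ⟨Metric.ball_subset_closedBall h.1, h.2⟩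

theorem dirDeriv_eq_zero
    (hφ : ∀ p ∉ Metric.closedBall (0 : Euc n) 2 ×ˢ Icc (-2 : ℝ) 2, φ p = 0) (e : Euc n × ℝ) :
    ∀ p ∉ Metric.closedBall (0 : Euc n) 2 ×ˢ Icc (-2 : ℝ) 2, dirDeriv e φ p = 0 := by
  intro p hp
  have h1 : φ =ᶠ[𝓝 p] fun _ => 0 := by
    filter_upwards [(Metric.isClosed_closedBall.prod isClosed_Icc).isOpen_compl.mem_nhds hp]
      with q hq using hφ q hq
  simp [dirDeriv, h1.fderiv_eq]

theorem contDiff_rescale (hφ : ContDiff ℝ ∞ φ) : ContDiff ℝ ∞ (rescale φ p₀ s) := by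
  unfold rescale
  fun_prop

theorem contDiff_dirDeriv (hφ : ContDiff ℝ ∞ φ) (e : Euc n × ℝ) : ContDiff ℝ ∞ (dirDeriv e φ) :=
  (hφ.fderiv_right (m := ∞) (by simp)).clm_apply contDiff_const

theorem dirDeriv_rescale (hφ : ContDiff ℝ ∞ φ) (e p : Euc n × ℝ) :
    dirDeriv e (rescale φ p₀ s) p =
      fderiv ℝ φ (s • (p.1 - p₀.1), s ^ 2 * (p.2 - p₀.2)) (s • e.1, s ^ 2 * e.2) := by
  have h1 : HasFDerivAt (fun p : Euc n × ℝ => (s • (p.1 - p₀.1), s ^ 2 * (p.2 - p₀.2)))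
      ((s • ContinuousLinearMap.fst ℝ (Euc n) ℝ).prod
        (s ^ 2 • ContinuousLinearMap.snd ℝ (Euc n) ℝ)) p :=
    ((hasFDerivAt_fst.sub_const p₀.1).const_smul s).prodMk
      ((hasFDerivAt_snd.sub_const p₀.2).const_mul (s ^ 2))
  have h2 := ((hφ.differentiable (by simp)).differentiableAt
    (x := (s • (p.1 - p₀.1), s ^ 2 * (p.2 - p₀.2)))).hasFDerivAt.comp p h1
  rw [dirDeriv, show rescale φ p₀ s = φ ∘ fun p : Euc n × ℝ =>
    (s • (p.1 - p₀.1), s ^ 2 * (p.2 - p₀.2)) from rfl, h2.fderiv]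
  simp

theorem dirDeriv_spaceDir_rescale (hφ : ContDiff ℝ ∞ φ) (i : Fin n) :
    dirDeriv (spaceDir i) (rescale φ p₀ s) =
      fun p => s * rescale (dirDeriv (spaceDir i) φ) p₀ s p := by
  funext p
  rw [dirDeriv_rescale hφ, rescale, dirDeriv, ← smul_eq_mul s, ← map_smul]
  simp [spaceDir]

theorem dirDeriv_timeDir_rescale (hφ : ContDiff ℝ ∞ φ) (p : Euc n × ℝ) :
    dirDeriv timeDir (rescale φ p₀ s) p = s ^ 2 * rescale (dirDeriv timeDir φ) p₀ s p := by
  rw [dirDeriv_rescale hφ, rescale, dirDeriv, ← smul_eq_mul (s ^ 2) (fderiv ℝ φ _ _), ← map_smul]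
  simp [timeDir]

theorem scale_pos (hr : 1 ≤ r) (k : ℕ) : 0 < scale r k := by
  unfold scale
  positivity

theorem two_pow_le_scale (hr : 1 ≤ r) (k : ℕ) : (2 : ℝ) ^ (k + 1) ≤ scale r k :=
  le_mul_of_one_le_left (by positivity) hr

theorem one_le_scale (hr : 1 ≤ r) (k : ℕ) : 1 ≤ scale r k :=
  (one_le_pow₀ (by norm_num)).trans (two_pow_le_scale hr k)

theorem scale_mono (hr : 1 ≤ r) : Monotone (scale r) := by
  intro j k h
  unfold scale
  gcongr
  norm_num

theorem two_mul_scale_le (hr : 1 ≤ r) {j k : ℕ} (h : j < k) : 2 * scale r j ≤ scale r k := by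
  refine le_trans (le_of_eq ?_) (scale_mono hr (Nat.succ_le_of_lt h))
  simp only [scale, Nat.succ_eq_add_one]
  ring

theorem box_scale_anti (hr : 1 ≤ r) : Antitone fun k => box p₀ (scale r k) :=
  fun j _ h => box_anti (scale_pos hr j) (scale_mono hr h)

theorem exists_notMem_box (hr : 1 ≤ r) {p : Euc n × ℝ} (hp : p ≠ p₀) :
    ∃ k, p ∉ box p₀ (scale r k) := by
  obtain ⟨k, hk⟩ := exists_pow_lt_of_lt_one (dist_pos.2 hp) (show (1 / 2 : ℝ) < 1 by norm_num)
  refine ⟨k, fun h => ?_⟩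
  have h1 := one_le_scale hr k
  have h2 : 2 / scale r k ≤ (1 / 2) ^ k := by
    rw [div_le_iff₀ (by linarith)]
    have h3 := mul_le_mul_of_nonneg_left (two_pow_le_scale hr k)
      (show (0:ℝ) ≤ (1 / 2) ^ k by positivity)
    have h4 : (1 / 2 : ℝ) ^ k * 2 ^ (k + 1) = 2 := by
      rw [pow_succ, ← mul_assoc, ← mul_pow]
      norm_num
    linarith
  have h5 : 2 / scale r k ^ 2 ≤ 2 / scale r k := by
    gcongr
    nlinarith
  have h6 : dist p p₀ ≤ 2 / scale r k := by
    rw [Prod.dist_eq]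
    exact max_le h.1 (le_trans h.2 h5)
  linarith

/-! ### Local form, growth and unboundedness of the series -/

theorem series_eq_sum (hφ : IsCutoff φ) (hr : 1 ≤ r) {p : Euc n × ℝ} {k : ℕ}
    (hp : p ∉ box p₀ (scale r k)) : series φ p₀ r p =
      ∑ j ∈ Finset.range k, ((j : ℝ) + 1)⁻¹ * rescale φ p₀ (scale r j) p := by
  refine tsum_eq_sum fun j hj => ?_
  have hkj : k ≤ j := by simpa using hj
  rw [rescale_eq_zero (scale_pos hr j) hφ.eq_zero_closedBall
    (fun h => hp (box_scale_anti hr hkj h)), mul_zero]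

theorem eventuallyEq_sum (hφ : IsCutoff φ) (hr : 1 ≤ r) {p : Euc n × ℝ} {k : ℕ}
    (hp : p ∉ box p₀ (scale r k)) : series φ p₀ r =ᶠ[𝓝 p] fun q =>
      ∑ j ∈ Finset.range k, ((j : ℝ) + 1)⁻¹ * rescale φ p₀ (scale r j) q := by
  filter_upwards [isCompact_box.isClosed.isOpen_compl.mem_nhds hp] with q hq
  exact series_eq_sum hφ hr hq

theorem isSmoothOff_series (hφ : IsCutoff φ) (hr : 1 ≤ r) :
    IsSmoothOff p₀ (Metric.closedBall p₀.1 (2 / scale r 0))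
      (Metric.closedBall p₀.2 (2 / scale r 0 ^ 2)) (series φ p₀ r) where
  compact_space := isCompact_closedBall _ _
  compact_time := isCompact_closedBall _ _
  smooth p hp := by
    obtain ⟨k, hk⟩ := exists_notMem_box hr hp
    refine ContDiffAt.congr_of_eventuallyEq ?_ (eventuallyEq_sum hφ hr hk)
    exact ContDiffAt.sum fun j _ =>
      contDiffAt_const.mul (contDiff_rescale hφ.smooth).contDiffAt
  zero p hp := by
    rw [series_eq_sum (k := 0) hφ hr hp]
    simp

/-- In the shell between the k-th box and the next, all later summands vanish and all earlier ones
are 1, so derivatives see one summand only. -/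
theorem series_eventuallyEq_const_add (hφ : IsCutoff φ) (hr : 1 ≤ r) {p : Euc n × ℝ} (hp : p ≠ p₀)
    (hps : ∀ k, ‖p.1 - p₀.1‖ ≠ 1 / scale r k) : ∃ (k : ℕ) (c : ℝ), series φ p₀ r =ᶠ[𝓝 p]
      fun q => c + ((k : ℝ) + 1)⁻¹ * rescale φ p₀ (scale r k) q := by
  classical
  have hex := exists_notMem_box hr hp
  have hN := Nat.find_spec hex
  rcases h0 : Nat.find hex with _ | k
  · rw [h0] at hN
    refine ⟨0, 0, ?_⟩
    filter_upwards [isCompact_box.isClosed.isOpen_compl.mem_nhds hN] with q hq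
    rw [series_eq_sum hφ hr hq, rescale_eq_zero (scale_pos hr 0) hφ.eq_zero_closedBall hq]
    simp
  · rw [h0] at hN
    have hk : p ∈ box p₀ (scale r k) := by
      have := Nat.find_min hex (m := k) (by omega)
      simpa using this
    refine ⟨k, ∑ j ∈ Finset.range k, ((j : ℝ) + 1)⁻¹, ?_⟩
    have hone : ∀ j ∈ Finset.range k, ∀ᶠ q in 𝓝 p, rescale φ p₀ (scale r j) q = 1 := by
      intro j hj
      have hsj := scale_pos hr j
      have h2 := two_mul_scale_le hr (Finset.mem_range.1 hj)
      rw [mem_box] at hk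
      -- In space, doubling gives only the non-strict bound, with equality possible for consecutive
      -- scales; this is why the spheres are excluded. In time the factor 4 leaves room.
      have h1 : ‖p.1 - p₀.1‖ < 1 / scale r j := by
        refine lt_of_le_of_ne (hk.1.trans ?_) (hps j)
        rw [div_le_div_iff₀ (by linarith) hsj]
        linarith
      have h3 : |p.2 - p₀.2| < 1 / scale r j ^ 2 := by
        refine hk.2.trans_lt ?_
        rw [div_lt_div_iff₀ (by nlinarith) (by positivity)]
        nlinarith
      have c1 : Continuous fun q : Euc n × ℝ => ‖q.1 - p₀.1‖ := by fun_prop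
      have c2 : Continuous fun q : Euc n × ℝ => |q.2 - p₀.2| := by fun_prop
      filter_upwards [c1.continuousAt.eventually (gt_mem_nhds h1),
        c2.continuousAt.eventually (gt_mem_nhds h3)] with q h4 h5
      exact rescale_eq_one hφ hsj h4 h5
    filter_upwards [eventuallyEq_sum hφ hr hN, (Finset.eventually_all _).2 hone] with q h1 h2
    rw [h1, Finset.sum_range_succ]
    congr 1
    exact Finset.sum_congr rfl fun j hj => by rw [h2 j hj, mul_one]

theorem series_eq_zero_or_le (hφ : IsCutoff φ) (hr : 1 ≤ r) {p : Euc n × ℝ} (hp : p ≠ p₀) :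
    series φ p₀ r p = 0 ∨ ∃ k : ℕ, p ∈ box p₀ (scale r k) ∧ 0 ≤ series φ p₀ r p ∧
      series φ p₀ r p ≤ (k : ℝ) + 1 := by
  classical
  have hex := exists_notMem_box hr hp
  have hN := Nat.find_spec hex
  rcases h0 : Nat.find hex with _ | k
  · left
    rw [h0] at hN
    rw [series_eq_sum hφ hr hN]
    simp
  · right
    rw [h0] at hN
    refine ⟨k, by simpa using Nat.find_min hex (m := k) (by omega), ?_, ?_⟩
    · rw [series_eq_sum hφ hr hN]
      exact Finset.sum_nonneg fun j _ => mul_nonneg (by positivity) (hφ.mem_Icc _).1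
    · rw [series_eq_sum hφ hr hN]
      have : ∀ j ∈ Finset.range (k + 1),
          ((j : ℝ) + 1)⁻¹ * rescale φ p₀ (scale r j) p ≤ 1 := fun j _ =>
        mul_le_one₀ (inv_le_one_of_one_le₀ (by linarith [Nat.cast_nonneg (α := ℝ) j]))
          (hφ.mem_Icc _).1 (hφ.mem_Icc _).2
      refine (Finset.sum_le_sum this).trans ?_
      simp

theorem harmonic_le_series (hφ : IsCutoff φ) (hr : 1 ≤ r) {p : Euc n × ℝ} (hp : p ≠ p₀) {k : ℕ}
    (h1 : ‖p.1 - p₀.1‖ < 1 / scale r k) (h2 : |p.2 - p₀.2| < 1 / scale r k ^ 2) :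
    ∑ j ∈ Finset.range k, 1 / ((j : ℝ) + 1) ≤ series φ p₀ r p := by
  obtain ⟨m, hm⟩ := exists_notMem_box hr hp
  -- The maximum makes the finite sum long enough to contain the first `k` summands.
  have hm' : p ∉ box p₀ (scale r (max m k)) := fun h =>
    hm (box_scale_anti hr (le_max_left m k) h)
  rw [series_eq_sum hφ hr hm']
  refine le_trans (le_of_eq ?_) (Finset.sum_le_sum_of_subset_of_nonneg
    (Finset.range_mono (le_max_right m k))
    fun j _ _ => mul_nonneg (by positivity) (hφ.mem_Icc _).1)
  refine Finset.sum_congr rfl fun j hj => ?_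
  have hsj := scale_pos hr j
  have hjk := scale_mono hr (Finset.mem_range.1 hj).le
  rw [rescale_eq_one hφ hsj (h1.trans_le (by gcongr)) (h2.trans_le (by gcongr)), mul_one, one_div]

theorem series_notMem_LInfty (hφ : IsCutoff φ) (hr : 1 ≤ r) {Ω : Set (Euc n)} {T : ℝ}
    (hΩ : IsOpen Ω) (hx : p₀.1 ∈ Ω) (ht : p₀.2 ∈ Ioo 0 T) : series φ p₀ r ∉ LInfty Ω T := by
  intro h
  have h' : MemLp (series φ p₀ r) ⊤ (volume.restrict (Cyl Ω T)) := h
  have hC := ae_le_eLpNormEssSup (f := series φ p₀ r) (μ := volume.restrict (Cyl Ω T))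
  have hfin : eLpNormEssSup (series φ p₀ r) (volume.restrict (Cyl Ω T)) < ⊤ := by
    have := h'.2
    rwa [eLpNorm_exponent_top] at this
  set C := eLpNormEssSup (series φ p₀ r) (volume.restrict (Cyl Ω T))
  obtain ⟨k, hk⟩ := (Real.tendsto_sum_range_one_div_nat_succ_atTop.eventually_gt_atTop
    C.toReal).exists
  have hs := scale_pos hr k
  set U : Set (Euc n × ℝ) := (Metric.ball p₀.1 (1 / scale r k) ×ˢ
    Metric.ball p₀.2 (1 / scale r k ^ 2)) ∩ Cyl Ω T
  have hUo : IsOpen U := (Metric.isOpen_ball.prod Metric.isOpen_ball).inter (hΩ.prod isOpen_Ioo)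
  have hU0 : p₀ ∈ U := ⟨⟨Metric.mem_ball_self (by positivity), Metric.mem_ball_self (by positivity)⟩,
    hx, ht⟩
  have hpos : 0 < volume U := hUo.measure_pos volume ⟨p₀, hU0⟩
  have hcyl : MeasurableSet (Cyl Ω T) := (hΩ.prod isOpen_Ioo).measurableSet
  rw [ae_restrict_iff' hcyl] at hC
  have hnot : ∀ᵐ p : Euc n × ℝ, p ∉ U := by
    filter_upwards [hC, ae_snd_ne p₀.2] with p h1 h2 hpU
    have h3 := harmonic_le_series hφ hr (p := p) (fun h' => h2 (by rw [h']))
      (mem_ball_iff_norm.1 hpU.1.1) (mem_ball_iff_norm.1 hpU.1.2)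
    have h4 := ENNReal.toReal_mono hfin.ne (h1 hpU.2)
    rw [toReal_enorm] at h4
    linarith [le_abs_self (series φ p₀ r p), Real.norm_eq_abs (series φ p₀ r p)]
  exact hpos.ne' (by simpa [ae_iff] using hnot)

/-! ### Square integrability of the series and its derivatives -/

theorem volume_box_le (hn : 2 ≤ n) (hs : 1 ≤ s) : volume (box p₀ s) ≤
    ENNReal.ofReal (s⁻¹ ^ 4) * (ENNReal.ofReal (2 ^ n * 4) * volume (Metric.ball (0 : Euc n) 1)) := by
  have hs0 : 0 < s := by linarith
  have h1 : volume (box p₀ s) = volume (Metric.closedBall p₀.1 (2 / s)) *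
      volume (Metric.closedBall p₀.2 (2 / s ^ 2)) := Measure.prod_prod _ _
  rw [h1, Measure.addHaar_closedBall _ _ (by positivity), Real.volume_closedBall,
    finrank_euclideanSpace_fin, mul_right_comm, ← ENNReal.ofReal_mul (by positivity),
    ← mul_assoc (ENNReal.ofReal (s⁻¹ ^ 4)), ← ENNReal.ofReal_mul (by positivity)]
  gcongr ?_ * _
  refine ENNReal.ofReal_le_ofReal ?_
  -- The volume scales like `s⁻¹ ^ (n + 2)`; dimension at least two gives the fourth power that
  -- offsets two squared parabolic derivatives.
  have h2 : s⁻¹ ^ n ≤ s⁻¹ ^ 2 := pow_le_pow_of_le_one (by positivity) (inv_le_one_of_one_le₀ hs) hn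
  calc (2 / s) ^ n * (2 * (2 / s ^ 2)) = 2 ^ n * 4 * s⁻¹ ^ 2 * s⁻¹ ^ n := by
        rw [div_eq_mul_inv, mul_pow, div_eq_mul_inv, inv_pow]
        ring
    _ ≤ 2 ^ n * 4 * s⁻¹ ^ 2 * s⁻¹ ^ 2 := by gcongr
    _ = s⁻¹ ^ 4 * (2 ^ n * 4) := by ring

/-- The square of `F` is dominated by the sum of `c k` times the indicators of the boxes; their
overlap does no harm to an upper bound. -/
theorem memLp_of_le_on_boxes (hn : 2 ≤ n) (hr : 1 ≤ r) {F : Euc n × ℝ → ℝ}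
    (hF : AEStronglyMeasurable F volume) {c : ℕ → ℝ} (hc : ∀ k, 0 ≤ c k)
    (hsum : Summable fun k => c k * (scale r k)⁻¹ ^ 4)
    (h : ∀ᵐ p : Euc n × ℝ, F p = 0 ∨ ∃ k, p ∈ box p₀ (scale r k) ∧ F p ^ 2 ≤ c k) :
    MemLp F 2 volume := by
  rw [memLp_two_iff_lintegral hF]
  set B : ENNReal := ENNReal.ofReal (2 ^ n * 4) * volume (Metric.ball (0 : Euc n) 1)
  have hB : B ≠ ⊤ := ENNReal.mul_ne_top ENNReal.ofReal_ne_top measure_ball_lt_top.ne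
  have hbm : ∀ k, MeasurableSet (box p₀ (scale r k)) := fun k => isCompact_box.isClosed.measurableSet
  calc ∫⁻ p, ‖F p‖ₑ ^ 2
      ≤ ∫⁻ p, ∑' k, (box p₀ (scale r k)).indicator (fun _ => ENNReal.ofReal (c k)) p := by
        refine lintegral_mono_ae ?_
        filter_upwards [h] with p hp
        rcases hp with hp | ⟨k, hk, hp⟩
        · simp [hp]
        · refine le_trans ?_ (ENNReal.le_tsum k)
          rw [indicator_of_mem hk, Real.enorm_eq_ofReal_abs, ← ENNReal.ofReal_pow (abs_nonneg _),
            sq_abs]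
          exact ENNReal.ofReal_le_ofReal hp
    _ = ∑' k, ENNReal.ofReal (c k) * volume (box p₀ (scale r k)) := by
        rw [lintegral_tsum fun k => (measurable_const.indicator (hbm k)).aemeasurable]
        exact tsum_congr fun k => lintegral_indicator_const (hbm k) _
    _ ≤ ∑' k, ENNReal.ofReal (c k * (scale r k)⁻¹ ^ 4) * B := by
        refine ENNReal.tsum_le_tsum fun k => ?_
        rw [ENNReal.ofReal_mul (hc k), mul_assoc]
        gcongr
        exact volume_box_le hn (one_le_scale hr k)
    _ = (∑' k, ENNReal.ofReal (c k * (scale r k)⁻¹ ^ 4)) * B := ENNReal.tsum_mul_right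
    _ < ⊤ := ENNReal.mul_lt_top hsum.tsum_ofReal_lt_top hB.lt_top

/-- The borderline case is `m = 2`: the scales cancel exactly against the volume bound and only the
summable squares of `1 / (k + 1)` remain. The same weights unsquared diverge, which is what leaves
the series unbounded. -/
theorem memLp_of_ae_eq_rescale (hn : 2 ≤ n) (hr : 1 ≤ r) {F ψ : Euc n × ℝ → ℝ}
    (hF : AEStronglyMeasurable F volume) (hψc : Continuous ψ)
    (hψ : ∀ p ∉ Metric.closedBall (0 : Euc n) 2 ×ˢ Icc (-2 : ℝ) 2, ψ p = 0) {m : ℕ} (hm : m ≤ 2)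
    (h : ∀ᵐ p : Euc n × ℝ, ∃ k : ℕ,
      F p = ((k : ℝ) + 1)⁻¹ * (scale r k ^ m * rescale ψ p₀ (scale r k) p)) :
    MemLp F 2 volume := by
  obtain ⟨M, hM⟩ : ∃ M, ∀ p, ‖ψ p‖ ≤ M := by
    refine HasCompactSupport.exists_bound_of_continuous ?_ hψc
    refine HasCompactSupport.intro ((isCompact_closedBall (0 : Euc n) 2).prod isCompact_Icc) hψ
  have hM0 : 0 ≤ M := (norm_nonneg _).trans (hM 0)
  refine memLp_of_le_on_boxes (p₀ := p₀) (r := r) hn hr hF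
    (c := fun k => (((k : ℝ) + 1)⁻¹ * (scale r k ^ 2 * M)) ^ 2) (fun k => sq_nonneg _) ?_ ?_
  · have h1 : Summable fun k : ℕ => (1 / ((k + 1 : ℕ) : ℝ) ^ 2) * M ^ 2 :=
      (((summable_nat_add_iff 1).2 (Real.summable_one_div_nat_pow.2 one_lt_two))).mul_right _
    refine h1.congr fun k => ?_
    have := scale_pos hr k
    push_cast
    field_simp
  · filter_upwards [h] with p ⟨k, hk⟩
    by_cases hp : p ∈ box p₀ (scale r k)
    · refine Or.inr ⟨k, hp, ?_⟩
      rw [← sq_abs, hk, abs_mul, abs_mul, abs_of_nonneg (by positivity),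
        abs_of_nonneg (pow_nonneg (scale_pos hr k).le m)]
      have h2 : |rescale ψ p₀ (scale r k) p| ≤ M := hM _
      have h3 := scale_pos hr k
      gcongr
      exact one_le_scale hr k
    · left
      rw [hk, rescale_eq_zero (scale_pos hr k) hψ hp]
      simp

/-- The summand `0 +` keeps the conclusion in the shape of the hypothesis, so that the lemma can be
iterated for second derivatives. -/
theorem dirDeriv_eventuallyEq {y R : Euc n × ℝ → ℝ} {p : Euc n × ℝ} {a c : ℝ}
    (h : y =ᶠ[𝓝 p] fun q => c + a * R q) (hR : ContDiff ℝ ∞ R) (e : Euc n × ℝ) :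
    dirDeriv e y =ᶠ[𝓝 p] fun q => 0 + a * dirDeriv e R q := by
  filter_upwards [h.fderiv (𝕜 := ℝ)] with q hq
  have hd : DifferentiableAt ℝ R q := (hR.differentiable (by simp)).differentiableAt
  rw [dirDeriv, hq, fderiv_const_add, fderiv_const_mul hd]
  simp [dirDeriv]

theorem ae_series_eventuallyEq (hφ : IsCutoff φ) (hr : 1 ≤ r) :
    ∀ᵐ p : Euc n × ℝ, ∃ (k : ℕ) (c : ℝ), series φ p₀ r =ᶠ[𝓝 p]
      fun q => c + ((k : ℝ) + 1)⁻¹ * rescale φ p₀ (scale r k) q := by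
  have h1 : ∀ᵐ x : Euc n, ∀ k, ‖x - p₀.1‖ ≠ 1 / scale r k := by
    refine ae_all_iff.2 fun k => ?_
    have h2 : volume (Metric.sphere p₀.1 (1 / scale r k)) = 0 :=
      Measure.addHaar_sphere_of_ne_zero volume _ (one_div_pos.2 (scale_pos hr k)).ne'
    rw [ae_iff]
    refine measure_mono_null (fun x hx => ?_) h2
    rw [mem_sphere_iff_norm]
    exact not_not.1 hx
  have h3 := (Measure.quasiMeasurePreserving_fst (μ := (volume : Measure (Euc n)))
    (ν := (volume : Measure ℝ))).ae h1
  filter_upwards [h3, ae_snd_ne p₀.2] with p h4 h5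
  exact series_eventuallyEq_const_add hφ hr (fun h' => h5 (by rw [h'])) h4

theorem aestronglyMeasurable_series (hφ : IsCutoff φ) (hr : 1 ≤ r) :
    AEStronglyMeasurable (series φ p₀ r) volume := by
  refine aestronglyMeasurable_of_tendsto_ae atTop (f := fun k p =>
    ∑ j ∈ Finset.range k, ((j : ℝ) + 1)⁻¹ * rescale φ p₀ (scale r j) p) (fun k => ?_) ?_
  · refine Continuous.aestronglyMeasurable ?_
    exact continuous_finsetSum _ fun j _ =>
      continuous_const.mul (contDiff_rescale hφ.smooth).continuous
  · filter_upwards [ae_snd_ne p₀.2] with p hp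
    obtain ⟨m, hm⟩ := exists_notMem_box hr (p := p) (p₀ := p₀) (fun h' => hp (by rw [h']))
    refine tendsto_const_nhds.congr' ?_
    filter_upwards [eventually_ge_atTop m] with k hk
    exact series_eq_sum hφ hr fun h' => hm (box_scale_anti hr hk h')

theorem memLp_series_pow (hn : 2 ≤ n) (hφ : IsCutoff φ) (hr : 1 ≤ r) {m : ℕ} (hm : m ≠ 0) :
    MemLp (fun p => series φ p₀ r p ^ m) 2 volume := by
  refine memLp_of_le_on_boxes (p₀ := p₀) (r := r) hn hr
    ((aestronglyMeasurable_series hφ hr).pow m) (c := fun k => ((k : ℝ) + 1) ^ (m * 2))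
    (fun k => by positivity) ?_ ?_
  · have h1 : Summable fun k : ℕ => ((k : ℝ) ^ (m * 2) * (1 / 2 : ℝ) ^ k) :=
      summable_pow_mul_geometric_of_norm_lt_one _ (by norm_num)
    refine Summable.of_nonneg_of_le (fun k => ?_) (fun k => ?_) ((summable_nat_add_iff 1).2 h1)
    · have := scale_pos hr k
      positivity
    · have h2 := two_pow_le_scale hr k
      have h3 := one_le_scale hr k
      -- One of the four powers already beats any polynomial in `k`.
      have h4 : (scale r k)⁻¹ ^ 4 ≤ (1 / 2) ^ (k + 1) := by
        calc (scale r k)⁻¹ ^ 4 ≤ (scale r k)⁻¹ ^ 1 :=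
              pow_le_pow_of_le_one (by positivity) (inv_le_one_of_one_le₀ h3) (by norm_num)
          _ ≤ ((2 : ℝ) ^ (k + 1))⁻¹ := by
              rw [pow_one]
              gcongr
          _ = (1 / 2) ^ (k + 1) := by rw [one_div, inv_pow]
      push_cast
      gcongr
  · filter_upwards [ae_snd_ne p₀.2] with p hp
    rcases series_eq_zero_or_le hφ hr (p := p) (p₀ := p₀) (fun h' => hp (by rw [h'])) with
      h | ⟨k, hk, h0, h1⟩
    · left
      rw [h, zero_pow hm]
    · refine Or.inr ⟨k, hk, ?_⟩
      rw [← pow_mul]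
      gcongr

theorem isRegularOff_series (hn : 2 ≤ n) (hφ : IsCutoff φ) (hr : 1 ≤ r) :
    IsRegularOff p₀ (Metric.closedBall p₀.1 (2 / scale r 0))
      (Metric.closedBall p₀.2 (2 / scale r 0 ^ 2)) (series φ p₀ r) where
  toIsSmoothOff := isSmoothOff_series hφ hr
  memLp_zero := by simpa using memLp_series_pow (p₀ := p₀) hn hφ hr one_ne_zero
  memLp_space i := by
    refine memLp_of_ae_eq_rescale (p₀ := p₀) hn hr
      (measurable_fderiv_apply_const ℝ _ _).aestronglyMeasurable
      (contDiff_dirDeriv hφ.smooth (spaceDir i)).continuous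
      (dirDeriv_eq_zero hφ.eq_zero_closedBall (spaceDir i)) (m := 1) (by norm_num) ?_
    filter_upwards [ae_series_eventuallyEq (p₀ := p₀) hφ hr] with p ⟨k, c, h⟩
    refine ⟨k, ?_⟩
    rw [(dirDeriv_eventuallyEq h (contDiff_rescale hφ.smooth) _).eq_of_nhds,
      dirDeriv_spaceDir_rescale hφ.smooth]
    ring
  memLp_time := by
    refine memLp_of_ae_eq_rescale (p₀ := p₀) hn hr
      (measurable_fderiv_apply_const ℝ _ _).aestronglyMeasurable
      (contDiff_dirDeriv hφ.smooth timeDir).continuous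
      (dirDeriv_eq_zero hφ.eq_zero_closedBall timeDir) (m := 2) le_rfl ?_
    filter_upwards [ae_series_eventuallyEq (p₀ := p₀) hφ hr] with p ⟨k, c, h⟩
    refine ⟨k, ?_⟩
    rw [(dirDeriv_eventuallyEq h (contDiff_rescale hφ.smooth) _).eq_of_nhds,
      dirDeriv_timeDir_rescale hφ.smooth]
    ring
  memLp_space_space i j := by
    have hj := contDiff_dirDeriv hφ.smooth (spaceDir j)
    refine memLp_of_ae_eq_rescale (p₀ := p₀) hn hr
      (measurable_fderiv_apply_const ℝ _ _).aestronglyMeasurable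
      (contDiff_dirDeriv hj (spaceDir i)).continuous
      (dirDeriv_eq_zero (dirDeriv_eq_zero hφ.eq_zero_closedBall (spaceDir j)) (spaceDir i))
      (m := 2) le_rfl ?_
    filter_upwards [ae_series_eventuallyEq (p₀ := p₀) hφ hr] with p ⟨k, c, h⟩
    refine ⟨k, ?_⟩
    have h1 := dirDeriv_eventuallyEq h (contDiff_rescale hφ.smooth) (spaceDir j)
    simp only [dirDeriv_spaceDir_rescale hφ.smooth, ← mul_assoc] at h1
    rw [(dirDeriv_eventuallyEq h1 (contDiff_rescale hj) (spaceDir i)).eq_of_nhds,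
      dirDeriv_spaceDir_rescale hj]
    ring

/-! ### The cut-off, the witness and the conclusions -/

theorem exists_isCutoff (n : ℕ) : ∃ φ : Euc n × ℝ → ℝ, IsCutoff φ := by
  let a : ContDiffBump (0 : Euc n) := ⟨1, 2, by norm_num, by norm_num⟩
  let b : ContDiffBump (0 : ℝ) := ⟨1, 2, by norm_num, by norm_num⟩
  have hz : ∀ p ∉ Metric.ball (0 : Euc n) 2 ×ˢ Icc (-2 : ℝ) 2, a p.1 * b p.2 = 0 := by
    intro p hp
    by_cases h1 : p.1 ∈ Metric.ball (0 : Euc n) 2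
    · have h2 : b p.2 = 0 := by
        refine b.zero_of_le_dist (le_of_lt ?_)
        by_contra h3
        rw [Real.dist_eq, sub_zero, not_lt] at h3
        exact hp ⟨h1, abs_le.1 h3⟩
      rw [h2, mul_zero]
    · rw [a.zero_of_le_dist (not_lt.1 h1), zero_mul]
  refine ⟨fun p => a p.1 * b p.2, ?_, ?_, ?_, ?_, hz⟩
  · exact (a.contDiff.comp contDiff_fst).mul (b.contDiff.comp contDiff_snd)
  · refine HasCompactSupport.intro ((isCompact_closedBall (0 : Euc n) 2).prod isCompact_Icc)
      fun p hp => hz p fun h => hp ⟨Metric.ball_subset_closedBall h.1, h.2⟩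
  · exact fun p => ⟨mul_nonneg a.nonneg b.nonneg, mul_le_one₀ a.le_one b.nonneg b.le_one⟩
  · intro p hp
    rw [a.one_of_mem_closedBall (Metric.ball_subset_closedBall hp.1), b.one_of_mem_closedBall, one_mul]
    rw [mem_closedBall_zero_iff, Real.norm_eq_abs]
    exact abs_le.2 hp.2

theorem term_succ_eq (φ : Euc n × ℝ → ℝ) (k : ℕ) (p : Euc n × ℝ) :
    term φ (k + 1) p = ((k : ℝ) + 1)⁻¹ * rescale φ (0, 1) (scale 1 k) p := by
  simp only [term, rescale, scale, one_mul, sub_zero, Nat.cast_add, Nat.cast_one]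
  rw [← pow_mul, mul_comm (k + 1) 2]

theorem witness_eq_series (φ : Euc n × ℝ → ℝ) : witness φ = series φ (0, 1) 1 := by
  funext p
  exact tsum_congr fun k => term_succ_eq φ k p

theorem finite_term_ne_zero (hφ : IsCutoff φ) {p : Euc n × ℝ} (hp : p ≠ (0, 1)) :
    {k : ℕ | 1 ≤ k ∧ term φ k p ≠ 0}.Finite := by
  obtain ⟨m, hm⟩ := exists_notMem_box (r := 1) le_rfl hp
  refine (finite_le_nat m).subset ?_
  rintro k ⟨h1, h2⟩
  obtain ⟨j, rfl⟩ := Nat.exists_eq_add_of_le' h1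
  by_contra h3
  have hmj : m ≤ j := by
    have : ¬ j + 1 ≤ m := h3
    omega
  refine h2 ?_
  rw [term_succ_eq, rescale_eq_zero (scale_pos le_rfl j) hφ.eq_zero_closedBall
    (fun h => hm (box_scale_anti le_rfl hmj h)), mul_zero]

theorem not_strongSpace_subset_LInfty (hn : 2 ≤ n) {Ω : Set (Euc n)} {T : ℝ} (hΩ : IsOpen Ω)
    (hne : Ω.Nonempty) (hT : 0 < T) : ¬ strongSpace Ω T ⊆ LInfty Ω T := by
  obtain ⟨φ, hφ⟩ := exists_isCutoff n
  obtain ⟨x₀, hx₀⟩ := hne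
  obtain ⟨ε, hε, hball⟩ := Metric.isOpen_iff.1 hΩ x₀ hx₀
  have hε' : 0 < 1 / ε := by positivity
  have hT' : 0 < 1 / T := by positivity
  -- With this `r` the largest box has space radius `1 / r < ε` and time radius at most `1 / (2 * r)
  -- < T / 2`, so it fits into the cylinder around `(x₀, T / 2)`.
  set r : ℝ := 1 + 1 / ε + 1 / T with hrdef
  have hr : 1 ≤ r := by linarith
  have hs : scale r 0 = r * 2 := by simp [scale]
  have hrε : 1 / r < ε := (one_div_lt (by linarith) hε).2 (by linarith)
  have hrT : 1 / r < T := (one_div_lt (by linarith) hT).2 (by linarith)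
  have h1 : 2 / scale r 0 = 1 / r := by
    rw [hs]
    field_simp
  have h2 : 2 / scale r 0 ^ 2 ≤ (1 / r) / 2 := by
    rw [hs, div_div, div_le_div_iff₀ (by positivity) (by positivity)]
    nlinarith
  intro h
  refine series_notMem_LInfty (p₀ := (x₀, T / 2)) hφ hr hΩ hx₀ ⟨by simpa using hT, by simpa using hT⟩
    (h ((isRegularOff_series hn hφ hr).mem_strongSpace (by omega) ?_ ?_))
  · rw [h1]
    exact (Metric.closedBall_subset_ball hrε).trans hball
  · rw [Real.closedBall_eq_Icc]
    intro t ht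
    have h3 := ht.1
    have h4 := ht.2
    exact ⟨by linarith, by linarith⟩

end Series

end ParabolicExample

open ParabolicExample

theorem mainTheorem8 (n : ℕ) (hn : 2 ≤ n) :
    (∀ (Ω : Set (Euc n)) (T : ℝ), IsOpen Ω → Ω.Nonempty → 0 < T →
      ¬ strongSpace Ω T ⊆ LInfty Ω T) ∧
    (∃ φ : Euc n × ℝ → ℝ, IsCutoff φ) ∧
    ∀ φ : Euc n × ℝ → ℝ, IsCutoff φ →
      (∀ p : Euc n × ℝ, p ≠ (0, 1) → {k : ℕ | 1 ≤ k ∧ term φ k p ≠ 0}.Finite) ∧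
      witness φ ∈ strongSpace (Metric.ball (0 : Euc n) 2) 2 ∧
      (∀ x : Euc n, witness φ (x, 0) = 0) ∧
      witness φ ∉ LInfty (Metric.ball (0 : Euc n) 2) 2 ∧
      (MemLp (heat (witness φ)) 2 (volume.restrict (Cyl (Metric.ball (0 : Euc n) 2) 2)) ∧
        IsState (Metric.ball (0 : Euc n) 2) 2 (fun _ => 0)
          (heat (witness φ)) 0 (witness φ)) ∧
      (n = 2 ∨ n = 3 →
        MemLp (fun p => heat (witness φ) p + witness φ p ^ 3) 2
          (volume.restrict (Cyl (Metric.ball (0 : Euc n) 2) 2)) ∧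
        IsState (Metric.ball (0 : Euc n) 2) 2 (fun s => s ^ 3)
          (fun p => heat (witness φ) p + witness φ p ^ 3) 0 (witness φ)) := by
  refine ⟨fun Ω T hΩ hne hT => not_strongSpace_subset_LInfty hn hΩ hne hT, exists_isCutoff n,
    fun φ hφ => ⟨fun p hp => finite_term_ne_zero hφ hp, ?_⟩⟩
  rw [witness_eq_series]
  have hreg := isRegularOff_series (p₀ := ((0 : Euc n), (1 : ℝ))) (r := 1) hn hφ le_rfl
  have hn0 : 0 < n := by omega
  -- The largest box is thus the closed unit ball times `[1/2, 3/2]`, inside the cylinder.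
  have hs : scale 1 0 = 2 := by simp [scale]
  have hK : Metric.closedBall (0 : Euc n) (2 / scale 1 0) ⊆ Metric.ball 0 2 := by
    rw [hs]
    exact Metric.closedBall_subset_ball (by norm_num)
  have hJ : Metric.closedBall (1 : ℝ) (2 / scale 1 0 ^ 2) ⊆ Ioo 0 2 := by
    rw [hs, Real.closedBall_eq_Icc]
    intro t ht
    have h1 := ht.1
    have h2 := ht.2
    constructor <;> linarith
  have hcube := memLp_series_pow (p₀ := ((0 : Euc n), (1 : ℝ))) (r := 1) hn hφ le_rfl three_ne_zero
  refine ⟨hreg.mem_strongSpace hn0 hK hJ, fun x => hreg.zero _ fun h => ?_,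
    series_notMem_LInfty hφ le_rfl Metric.isOpen_ball (Metric.mem_ball_self (by norm_num))
      ⟨by norm_num, by norm_num⟩, ⟨hreg.memLp_heat.restrict _, ?_⟩, fun _ => ⟨?_, ?_⟩⟩
  · exact lt_irrefl _ (hJ h.2).1
  · have hsol := hreg.isSolution (T := 2) (f := fun _ => 0)
      (u := heat (series φ (0, 1) 1)) hn0 two_pos hK hJ MemLp.zero' (fun p => (add_zero _).symm)
    exact ⟨hsol, fun z hz => hsol.ae_eq two_pos monotone_const hz⟩
  · exact (hreg.memLp_heat.add hcube).restrict _
  · have hsol := hreg.isSolution (T := 2) (f := fun s => s ^ 3)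
      (u := fun p => heat (series φ (0, 1) 1) p + series φ (0, 1) 1 p ^ 3) hn0 two_pos hK hJ
      (hcube.restrict _) (fun p => rfl)
    exact ⟨hsol, fun z hz => hsol.ae_eq two_pos (Odd.strictMono_pow (by decide)).monotone hz⟩
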